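/- Let $X^8=\{z\in\mathbb C^5 : z_1^2+\dots+z_5^2=1\}\cong T^*S^4$ with the linear action of $SO(5)$, let $r=|z|\ge 1$, and let $S^4=X^8\cap\mathbb R^5=\{r=1\}$ (the zero section). Write $z=x+iy$, $R_+=|x|$, $R_-=|y|$. Equip $X^8$ with the Stenzel Calabi-Yau structure: the Kähler form $\omega=\frac i2\partial\bar\partial\,\mathcal F(r^2)$ with $\mathcal F'(t)=(4/3)^{1/4}(t+2)^{1/4}(t+1)^{-1/2}$, the metric $g=\omega(\cdot,J\cdot)$, the orientation and volume form $\omega^4/4!$, and the holomorphic volume form $\Omega$ given by $\Omega=\frac1{z_i}dz_{i+1}\wedge\dots\wedge dz_{i-1}$ (indices mod 5) where $z_i\ne0$. Let $\Phi=\frac12\omega^2+\mathrm{Re}\,\Omega$. Let $M$ be $X^8$ or $X^8\setminus S^4$. We consider smooth connections $A\in\Omega^1(M;i\mathbb R)$ on the trivial bundle $M\times U(1)$ that are invariant under the $SO(5)$-action $h\cdot(z,u)=(hz,u)$. The connection $A$ is a Spin(7) instanton if $\star_gF_A=-\Phi\wedge F_A$, and it is Hermitian Yang-Mills (HYM) if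 $F_A\wedge\star_g\omega=0$ and $F_A\wedge\Omega=0$, where $F_A=dA$. It is called trivial if an $SO(5)$-equivariant gauge transformation $M\to U(1)$ takes it to $0$. (1) Let $A$ be a nontrivial invariant $U(1)$-connection on $X^8\setminus S^4$ that is a Spin(7) instanton or HYM. Then there is a constant $L>0$ with $$\lim_{r\to1}|r-1|^{4}\,\|F_A\|_g^2=L,$$ so that $\lim_{r\to1}\|F_A\|_g^2=+\infty$. In particular, no smooth connection on $X^8\times U(1)$ restricts on $X^8\setminus S^4$ to a connection that is gauge equivalent to $A$; that is, $A$ does not extend smoothly over $S^4$. (2) Let $A$ be an invariant $U(1)$-connection on all of $X^8$ that is a Spin(7) instanton or HYM. Then $A$ is trivial. If moreover $A$ is in temporal gauge, i.e. $A(\partial_r)=0$ on $X^8\setminus S^4$, where $\partial_r=\frac{r}{2R_+^2}\sum_j x^j\partial_{x^j}+\frac{r}{2R_-^2}\sum_j y^j\partial_{y^j}$, then $A=0$. -/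

import Mathlib

open Filter Topology Set
open scoped ContDiff

noncomputable section

namespace Stenzel

/-! ### The affine quadric and its `SO(5)`-action -/

/-- The ambient complex vector space `ℂ⁵`, regarded as a real normed space. -/
abbrev E : Type := Fin 5 → ℂ

/-- The Stenzel manifold `X⁸ = {z₁² + ⋯ + z₅² = 1} ⊂ ℂ⁵`, which is diffeomorphic to `T*S⁴`. -/
def X : Set E := {z | ∑ j, z j ^ 2 = 1}

/-- `r² = |z₁|² + ⋯ + |z₅|²`. -/
def radiusSq (z : E) : ℝ := ∑ j, Complex.normSq (z j)

/-- The radial coordinate `r`. -/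
def radius (z : E) : ℝ := √(radiusSq z)

/-- The singular orbit: the real points of the quadric, i.e. the zero section of `T*S⁴`. -/
def S4 : Set E := {z | z ∈ X ∧ ∀ j, (z j).im = 0}

/-- The real tangent space `T_z X = {v ∈ ℂ⁵ | z₁v₁ + ⋯ + z₅v₅ = 0}` at a point `z` of `X`. -/
def tangent (z : E) : Submodule ℝ E where
  carrier := {v | ∑ j, z j * v j = 0}
  zero_mem' := by simp
  add_mem' := by
    intro a b ha hb
    simp only [mem_ofPred_eq, Pi.add_apply, mul_add, Finset.sum_add_distrib] at *
    rw [ha, hb, add_zero]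
  smul_mem' := by
    intro c v hv
    simp only [mem_ofPred_eq, Pi.smul_apply, mul_smul_comm] at *
    rw [← Finset.smul_sum, hv, smul_zero]

/-- The linear action of a real `5 × 5` matrix on `ℂ⁵`; for matrices in `SO(5)` it preserves `X`. -/
def act (h : Matrix (Fin 5) (Fin 5) ℝ) : E →L[ℝ] E :=
  LinearMap.toContinuousLinearMap ((Matrix.mulVecLin (h.map Complex.ofReal)).restrictScalars ℝ)

/-- The vector field `∂_r = r/(2R₊²) ∑ xʲ ∂_{xʲ} + r/(2R₋²) ∑ yʲ ∂_{yʲ}` on `X ∖ S⁴`, where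
`z = x + iy`, `R₊² = |x|²` and `R₋² = |y|²`. -/
def radialField (z : E) : E := fun j =>
  ((radius z / (2 * ∑ k, (z k).re ^ 2) * (z j).re : ℝ) : ℂ) +
    ((radius z / (2 * ∑ k, (z k).im ^ 2) * (z j).im : ℝ) : ℂ) * Complex.I

/-! ### Multilinear algebra -/

/-- The wedge product of real-valued alternating forms, normalised so that
`(e¹ ∧ e²)(v₁, v₂) = e¹(v₁) e²(v₂) - e¹(v₂) e²(v₁)`. -/
def wedge {V : Type*} [AddCommGroup V] [Module ℝ V] {k l : ℕ}
    (α : V [⋀^Fin k]→ₗ[ℝ] ℝ) (β : V [⋀^Fin l]→ₗ[ℝ] ℝ) : V [⋀^Fin (k + l)]→ₗ[ℝ] ℝ :=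
  ((LinearMap.mul' ℝ ℝ).compAlternatingMap (α.domCoprod β)).domDomCongr finSumFinEquiv

section Hodge

variable {V : Type*} [AddCommGroup V] [Module ℝ V] [Module.Finite ℝ V]

/-- The inverse `(gⁱʲ)` of the Gram matrix `(g_{ij})` of `g` in a fixed basis `(b_i)` of `V`. -/
def invGram (g : V → V → ℝ) :
    Matrix (Fin (Module.finrank ℝ V)) (Fin (Module.finrank ℝ V)) ℝ :=
  (Matrix.of fun i j => g (Module.finBasis ℝ V i) (Module.finBasis ℝ V j))⁻¹

/-- The components `αⁱʲ = ∑ gⁱᵏ gʲˡ α(b_k, b_l)` of a `2`-form with both indices raised. -/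
def raise (g : V → V → ℝ) (α : V [⋀^Fin 2]→ₗ[ℝ] ℝ) (i j : Fin (Module.finrank ℝ V)) : ℝ :=
  ∑ k, ∑ l, invGram g i k * invGram g j l *
    α ![Module.finBasis ℝ V k, Module.finBasis ℝ V l]

/-- The squared norm `|α|² = ½ ∑ αⁱʲ α_{ij}` of a `2`-form; it does not depend on the basis, and
in a `g`-orthonormal basis it is `∑_{i < j} α_{ij}²`. -/
def formNormSq (g : V → V → ℝ) (α : V [⋀^Fin 2]→ₗ[ℝ] ℝ) : ℝ :=
  (1 / 2) * ∑ i, ∑ j, raise g α i j * α ![Module.finBasis ℝ V i, Module.finBasis ℝ V j]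

/-- The Hodge star of a `2`-form on an `8`-dimensional space with metric `g` and volume form `vol`:
`(⋆α)(v₁, …, v₆) = ½ ∑ αⁱʲ vol(b_i, b_j, v₁, …, v₆)`, so that `β ∧ ⋆α = ⟨β, α⟩ vol`. It does not
depend on the basis. -/
def hodgeStar (g : V → V → ℝ) (vol : V [⋀^Fin 8]→ₗ[ℝ] ℝ) (α : V [⋀^Fin 2]→ₗ[ℝ] ℝ) :
    V [⋀^Fin 6]→ₗ[ℝ] ℝ :=
  (1 / 2 : ℝ) • ∑ i, ∑ j, raise g α i j •
    (vol.curryLeft (Module.finBasis ℝ V i)).curryLeft (Module.finBasis ℝ V j)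

end Hodge

/-- The restriction of a form on `ℂ⁵` to the tangent space of `X` at `z`. -/
def restrict (z : E) {k : ℕ} (α : E [⋀^Fin k]→ₗ[ℝ] ℝ) : tangent z [⋀^Fin k]→ₗ[ℝ] ℝ :=
  α.compLinearMap (tangent z).subtype

/-! ### The Stenzel Calabi-Yau structure -/

/-- The Kähler potential `𝓕` of the Stenzel metric, as a function of `t = r²`: the primitive of
`𝓕'(t) = (4/3)^{1/4} (t + 2)^{1/4} (t + 1)^{-1/2}`. With this choice
`Q = R₊R₋𝓕'(r²) = ½ (4/3)^{1/4} (r² + 2)^{1/4} (r² - 1)^{1/2}`. -/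
def potential (t : ℝ) : ℝ :=
  ∫ s in (1 : ℝ)..t, (4 / 3 : ℝ) ^ (1 / 4 : ℝ) * (s + 2) ^ (1 / 4 : ℝ) * (s + 1) ^ (-(1 / 2) : ℝ)

/-- The complex structure: multiplication by `i`. -/
def J : E →L[ℝ] E := Complex.I • ContinuousLinearMap.id ℝ E

/-- The `1`-form `d(𝓕(r²)) ∘ J` on `ℂ⁵`. -/
def potentialForm (z : E) : E [⋀^Fin 1]→L[ℝ] ℝ :=
  ContinuousAlternatingMap.ofSubsingleton ℝ E ℝ (0 : Fin 1)
    ((fderiv ℝ (fun w => potential (radiusSq w)) z).comp J)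

/-- The form `(i/2) ∂∂̄ 𝓕(r²)` on `ℂ⁵`. Since `∂̄f = ½ (df + i df ∘ J)`, it equals
`-¼ d(d(𝓕(r²)) ∘ J)`. For `𝓕(t) = t` it would be `∑ dxʲ ∧ dyʲ`. -/
def kahlerAmbient (z : E) : E [⋀^Fin 2]→ₗ[ℝ] ℝ :=
  (-(1 / 4) : ℝ) • (extDeriv potentialForm z).toAlternatingMap

/-- The Kähler form `ω` on `T_z X`. -/
def omega (z : E) : tangent z [⋀^Fin 2]→ₗ[ℝ] ℝ := restrict z (kahlerAmbient z)

/-- The Stenzel metric `g(v, w) = ω(v, Jw)` on `T_z X`. -/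
def metric (z : E) (v w : tangent z) : ℝ := kahlerAmbient z ![(v : E), J (w : E)]

/-- The volume form `ω⁴/4!` on `T_z X`. -/
def vol (z : E) : tangent z [⋀^Fin 8]→ₗ[ℝ] ℝ :=
  (1 / 24 : ℝ) • wedge (wedge (wedge (omega z) (omega z)) (omega z)) (omega z)

/-- The holomorphic volume form: `Ω_z(v₁, …, v₄) = det(z, v₁, …, v₄)`. On `T_z X` it agrees with
`(1/zᵢ) dzⁱ⁺¹ ∧ ⋯ ∧ dzⁱ⁻¹` (indices mod 5) wherever `zᵢ ≠ 0`, see `coord_mul_holVol`. -/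
def holVol (z : E) : E [⋀^Fin 4]→ₗ[ℂ] ℂ :=
  (Matrix.detRowAlternating (n := Fin 5) (R := ℂ)).curryLeft z

theorem coord_mul_holVol {z : E} (hz : z ∈ X) (v : Fin 4 → E) (hv : ∀ k, v k ∈ tangent z)
    (i : Fin 5) :
    z i * holVol z v = Matrix.det (Matrix.of fun k l : Fin 4 => v k (i + 1 + l.castSucc)) := by
  have hz' : ∑ j, z j ^ 2 = 1 := hz
  have hv' : ∀ k, ∑ j, z j * v k j = 0 := hv
  have hc : ∀ (n : ℕ) (w : Fin (n + 1) → ℂ) (v : Fin n → Fin (n + 1) → ℂ),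
      Matrix.detRowAlternating (Matrix.vecCons w v) =
        Matrix.det (Matrix.of (Matrix.vecCons w v)) := fun _ _ _ => rfl
  have hd : ∀ w : E, holVol w v =
      Matrix.det (Matrix.of (Matrix.vecCons w v) : Matrix (Fin 5) (Fin 5) ℂ) := fun w => by
    rw [holVol, AlternatingMap.curryLeft_apply_apply, hc]
  have h0 : holVol (z i • z - Pi.single i 1) v = 0 := by
    rw [hd, ← Matrix.exists_mulVec_eq_zero_iff]
    refine ⟨z, ?_, ?_⟩
    · rintro rfl
      simp at hz'
    · funext k
      refine Fin.cases ?_ (fun k => ?_) k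
      · simp only [Matrix.mulVec, dotProduct, Matrix.of_apply, Matrix.cons_val_zero, Pi.sub_apply,
          Pi.smul_apply, smul_eq_mul, sub_mul, Finset.sum_sub_distrib, Pi.zero_apply,
          Pi.single_apply, ite_mul, one_mul, zero_mul, Finset.sum_ite_eq', Finset.mem_univ, if_true]
        have : ∀ x, z i * z x * z x = z i * z x ^ 2 := fun x => by ring
        simp only [this, ← Finset.mul_sum, hz']
        ring
      · simp only [Matrix.mulVec, dotProduct, Matrix.of_apply, Matrix.cons_val_succ, Pi.zero_apply]
        rw [← hv' k]
        exact Finset.sum_congr rfl fun _ _ => mul_comm _ _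
  have h1 : z i * holVol z v = holVol (Pi.single i 1) v := by
    have h2 : holVol (z i • z - Pi.single i 1) v = z i * holVol z v - holVol (Pi.single i 1) v := by
      simp [holVol, map_sub, map_smul]
    rw [h2] at h0
    exact sub_eq_zero.mp h0
  rw [h1, hd, Matrix.det_succ_row_zero, Finset.sum_eq_single i]
  rotate_left
  · intro b _ hb
    have h2 : (Pi.single i 1 : E) b = 0 := Pi.single_eq_of_ne hb 1
    simp only [Matrix.of_apply, Matrix.cons_val_zero, h2, mul_zero, zero_mul]
  · exact fun h => absurd (Finset.mem_univ i) h
  have hk : ∀ i : Fin 5, ∃ k : Fin 4, (∀ l : Fin 4, i + 1 + l.castSucc = i.succAbove (l + k)) ∧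
      Equiv.Perm.sign (Equiv.addRight k) = (-1) ^ (i : ℕ) := by decide
  obtain ⟨k, hk, hsgn⟩ := hk i
  have h3 := Matrix.det_permute' (Equiv.addRight k)
    (Matrix.of fun (m l : Fin 4) => v m (i.succAbove l))
  have h4 : (Matrix.of fun m l : Fin 4 => v m (i + 1 + l.castSucc)) =
      (Matrix.of fun m l : Fin 4 => v m (i.succAbove l)).submatrix id (Equiv.addRight k) := by
    ext m l
    simp only [hk, Matrix.submatrix_apply, Matrix.of_apply, id_eq, Equiv.coe_addRight]
  have h5 : (Pi.single i 1 : E) i = 1 := Pi.single_eq_same i 1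
  rw [h4, h3, hsgn]
  simp only [Matrix.of_apply, Matrix.cons_val_zero, h5, mul_one]
  push_cast
  rfl

/-- The real part of a complex-valued form. -/
def reForm {k : ℕ} (α : E [⋀^Fin k]→ₗ[ℂ] ℂ) : E [⋀^Fin k]→ₗ[ℝ] ℝ :=
  { Complex.reLm.compMultilinearMap (α.toMultilinearMap.restrictScalars ℝ) with
    map_eq_zero_of_eq' := by
      intro v i j h hij
      have : α v = 0 := α.map_eq_zero_of_eq v h hij
      change (α v).re = 0
      rw [this, Complex.zero_re] }

/-- The imaginary part of a complex-valued form. -/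
def imForm {k : ℕ} (α : E [⋀^Fin k]→ₗ[ℂ] ℂ) : E [⋀^Fin k]→ₗ[ℝ] ℝ :=
  { Complex.imLm.compMultilinearMap (α.toMultilinearMap.restrictScalars ℝ) with
    map_eq_zero_of_eq' := by
      intro v i j h hij
      have : α v = 0 := α.map_eq_zero_of_eq v h hij
      change (α v).im = 0
      rw [this, Complex.zero_im] }

/-- `Re Ω` on `T_z X`. -/
def reOmega (z : E) : tangent z [⋀^Fin 4]→ₗ[ℝ] ℝ := restrict z (reForm (holVol z))

/-- `Im Ω` on `T_z X`. -/
def imOmega (z : E) : tangent z [⋀^Fin 4]→ₗ[ℝ] ℝ := restrict z (imForm (holVol z))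

/-- The Cayley calibration `Φ = ω²/2 + Re Ω` on `T_z X`. -/
def cayley (z : E) : tangent z [⋀^Fin 4]→ₗ[ℝ] ℝ :=
  (1 / 2 : ℝ) • wedge (omega z) (omega z) + reOmega z

/-! ### `U(1)`-connections

`M` is `X` or `X ∖ S⁴`. A connection on the trivial bundle `M × U(1)` is `A = i a` for a real
`1`-form `a` on `M`, and its curvature is `F_A = i da`. The forms `a` on `M` are the restrictions
of forms defined near `M` in `ℂ⁵`, only the values on vectors tangent to `X` being relevant; every
smooth form on `M` arises in this way. -/

/-- A real `1`-form defined on (a part of) `ℂ⁵`. -/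
abbrev OneForm : Type := E → E [⋀^Fin 1]→L[ℝ] ℝ

/-- `a` is smooth on a neighbourhood of `M`, so that `A = i a` restricts to a smooth
`U(1)`-connection on `M`. -/
def IsConnection (M : Set E) (a : OneForm) : Prop :=
  ∃ W : Set E, IsOpen W ∧ M ⊆ W ∧ ContDiffOn ℝ ∞ a W

/-- Invariance of the connection on `M × U(1)` under the action `h • (z, u) = (h z, u)` of
`SO(5)`. -/
def IsInvariant (M : Set E) (a : OneForm) : Prop :=
  ∀ h ∈ Matrix.specialOrthogonalGroup (Fin 5) ℝ, ∀ z ∈ M, ∀ v ∈ tangent z,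
    a (act h z) ![act h v] = a z ![v]

/-- The curvature `F_A = i F`, `F = da`, on `T_z X`. -/
def curvature (a : OneForm) (z : E) : tangent z [⋀^Fin 2]→ₗ[ℝ] ℝ :=
  restrict z (extDeriv a z).toAlternatingMap

/-- The squared pointwise norm `‖F_A‖_g²` of the curvature in the Stenzel metric. -/
def curvatureNormSq (a : OneForm) (z : E) : ℝ := formNormSq (metric z) (curvature a z)

/-- The `Spin(7)` instanton equation `⋆F_A = -Φ ∧ F_A` on `M`. -/
def IsSpin7Instanton (M : Set E) (a : OneForm) : Prop :=
  ∀ z ∈ M, hodgeStar (metric z) (vol z) (curvature a z) = -wedge (cayley z) (curvature a z)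

/-- The Hermitian Yang-Mills equations `F_A ∧ ⋆ω = 0` and `F_A ∧ Ω = 0` on `M`. -/
def IsHYM (M : Set E) (a : OneForm) : Prop :=
  ∀ z ∈ M, wedge (curvature a z) (hodgeStar (metric z) (vol z) (omega z)) = 0 ∧
    wedge (curvature a z) (reOmega z) = 0 ∧ wedge (curvature a z) (imOmega z) = 0

/-- A smooth gauge transformation `u : M → U(1)`, represented by a complex function that is smooth
on a neighbourhood of `M`. -/
def IsGauge (M : Set E) (u : E → ℂ) : Prop :=
  (∃ W : Set E, IsOpen W ∧ M ⊆ W ∧ ContDiffOn ℝ ∞ u W) ∧ ∀ z ∈ M, ‖u z‖ = 1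

/-- The gauge transformation `u` relates `A = i a` to `B = i b` on `M`, i.e. `B = A + u⁻¹ du`. -/
def GaugeRelated (M : Set E) (u : E → ℂ) (a b : OneForm) : Prop :=
  ∀ z ∈ M, ∀ v ∈ tangent z,
    Complex.I * (b z ![v] : ℂ) = Complex.I * (a z ![v] : ℂ) + (u z)⁻¹ * fderiv ℝ u z v

/-- The connection `A = i a` is trivial on `M`: it is related to the zero connection by an
`SO(5)`-equivariant gauge transformation. -/
def IsTrivialConnection (M : Set E) (a : OneForm) : Prop :=
  ∃ u : E → ℂ, IsGauge M u ∧
    (∀ h ∈ Matrix.specialOrthogonalGroup (Fin 5) ℝ, ∀ z ∈ M, u (act h z) = u z) ∧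
    GaugeRelated M u 0 a

/-- The connection `A = i a` is in temporal gauge: `A(∂_r) = 0` on `X ∖ S⁴`. -/
def IsTemporal (a : OneForm) : Prop := ∀ z ∈ X \ S4, a z ![radialField z] = 0

end Stenzel

end

/-!
The quadric `X` has cohomogeneity one under `SO(5)`: every orbit meets the curve
`t ↦ (√((t+1)/2), i √((t-1)/2), 0, 0, 0)`, where `t = r²` (`exists_act_crossSection`). The
stabiliser of a point of `X ∖ S⁴` contains the diagonal matrices that flip two of the last three
coordinates, so an invariant `1`-form is `a = G(t) Im ∑ z̄ⱼ dzⱼ + P(t) dt` on the tangent spaces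
(`IsInvariant.eq_radial`). The stabiliser of a point of `S⁴` contains an element acting by
`-1` on the tangent space, so an invariant form vanishes there (`IsInvariant.eq_zero_of_mem_S4`).

The curvature `da` and the Kähler form are both combinations of `dt ∧ Im ∑ z̄ⱼ dzⱼ` and
`∑ dxʲ ∧ dyʲ` (`extDeriv_of_isInvariant`, `kahlerAmbient_apply`), hence are diagonalised by one
and the same unitary frame. In such a frame the Hodge star, the volume form `ω⁴/4!` and the
products with `ω` and `Re Ω` can be evaluated by hand. Both the `Spin(7)` instanton equation and
the Hermitian Yang-Mills equations force the sum of the four eigenvalues of `da` to vanish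
(`trace_and_norm`). Three of them are equal to `2G/𝓕'`, so this is a linear ordinary differential
equation for `G`. It says that `G 𝓕'³ (t² - 1)² = C` is constant, and
`‖F_A‖² = 48 (G/𝓕')²` (`exists_angularCoeff_mul_eq`).

If `C = 0`, then `a = P(t) dt` is the differential of a function of `t`, and `A` is trivial. For
`C ≠ 0` the squared norm of the curvature is `48 C² (r⁴ - 1)⁻⁴ 𝓕'(r²)⁻⁸`, which has a pole of order
four at `r = 1`. The curvature is gauge invariant (`extDeriv_eq_of_gaugeRelated`), and its value
`2G` on a fixed pair of vectors is unbounded near `S⁴`, so `A` does not extend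
(`eq_zero_of_curvature_extends`).

A connection on all of `X` therefore has `C = 0`. Its phase is the primitive of `P(t) dt` that
vanishes on `S⁴`, and only its smoothness across `S⁴` needs an argument. Pulled back to a
neighbourhood of `X` by the retraction `z ↦ z / √(∑ zⱼ²)`, the primitive is of order
`o(√(t - 1))`, and `√(t - 1)` is at most of the order of the distance to `S⁴`. Thus it is
differentiable along `S⁴` too, its differential is the smooth pullback of `a` everywhere, and it is
smooth (`isTrivialConnection_X_of_angularCoeff_eq_zero`).

Differential forms on `X` are given by forms on `ℂ⁵`. The restriction of `da` to `X` only depends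
on that of `a`, because forms can be pulled back by the retraction (`extDeriv_congr_of_tangent`).
-/

noncomputable section

namespace Stenzel

section Algebra

/-! ### Wedge products evaluated on adapted frames -/

/-- The shuffle sum defining the wedge product may be taken over any family of permutations that
lie in distinct classes and represent every class whose term does not vanish. -/
theorem wedge_apply_eq_sum {V : Type*} [AddCommGroup V] [Module ℝ V] {k l : ℕ}
    (α : V [⋀^Fin k]→ₗ[ℝ] ℝ) (β : V [⋀^Fin l]→ₗ[ℝ] ℝ) (v : Fin (k + l) → V)
    {ι : Type*} [Fintype ι] (σ : ι → Equiv.Perm (Fin k ⊕ Fin l))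
    (hinj : ∀ i j, i ≠ j → ∃ b a, σ j (Sum.inr b) = σ i (Sum.inl a))
    (hzero : ∀ τ : Equiv.Perm (Fin k ⊕ Fin l),
      (∀ i, ∃ b a, τ (Sum.inr b) = σ i (Sum.inl a)) →
        α (fun a => v (finSumFinEquiv (τ (Sum.inl a)))) *
          β (fun b => v (finSumFinEquiv (τ (Sum.inr b)))) = 0) :
    wedge α β v = ∑ i, ((Equiv.Perm.sign (σ i) : ℤ) : ℝ) *
      (α (fun a => v (finSumFinEquiv (σ i (Sum.inl a)))) *
        β (fun b => v (finSumFinEquiv (σ i (Sum.inr b))))) := by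
  have hterm : ∀ τ : Equiv.Perm (Fin k ⊕ Fin l),
      LinearMap.mul' ℝ ℝ (AlternatingMap.domCoprod.summand α β (Quotient.mk'' τ)
        (fun i => v (finSumFinEquiv i))) = ((Equiv.Perm.sign τ : ℤ) : ℝ) *
      (α (fun a => v (finSumFinEquiv (τ (Sum.inl a)))) *
        β (fun b => v (finSumFinEquiv (τ (Sum.inr b))))) := by
    intro τ
    rw [AlternatingMap.domCoprod.summand_mk'']
    change LinearMap.mul' ℝ ℝ (Equiv.Perm.sign τ •
      TensorProduct.tmul ℝ (α (fun a => v (finSumFinEquiv (τ (Sum.inl a)))))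
        (β (fun b => v (finSumFinEquiv (τ (Sum.inr b)))))) = _
    rw [Units.smul_def, map_zsmul, LinearMap.mul'_apply, zsmul_eq_mul]
  have hclass : ∀ τ υ : Equiv.Perm (Fin k ⊕ Fin l),
      (Quotient.mk'' τ : Equiv.Perm.ModSumCongr (Fin k) (Fin l)) = Quotient.mk'' υ ↔
        ¬ ∃ b a, υ (Sum.inr b) = τ (Sum.inl a) := by
    intro τ υ
    rw [Quotient.eq'', QuotientGroup.leftRel_apply]
    constructor
    · rintro ⟨⟨p, q⟩, h⟩ ⟨b, a, hba⟩
      have h1 : υ (Sum.inr b) = τ (Sum.inr (q b)) := by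
        have := congrArg (fun f => τ (f (Sum.inr b))) h
        simpa using this.symm
      rw [hba] at h1
      simpa using τ.injective h1
    · intro h
      push Not at h
      refine Equiv.Perm.mem_sumCongrHom_range_of_perm_mapsTo_inl
        ((Equiv.Perm.perm_mapsTo_inl_iff_mapsTo_inr _).2 ?_)
      rintro _ ⟨b, rfl⟩
      rcases hx : (τ⁻¹ * υ) (Sum.inr b) with a | c
      · refine absurd ?_ (h b a)
        rw [← hx]
        simp
      · exact ⟨c, rfl⟩
  have hw : wedge α β v = ∑ q, LinearMap.mul' ℝ ℝ (AlternatingMap.domCoprod.summand α β q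
        (fun i => v (finSumFinEquiv i))) := by
    rw [← map_sum, ← sum_apply]
    rfl
  rw [hw]
  symm
  refine Fintype.sum_of_injective
    (fun i => (Quotient.mk'' (σ i) : Equiv.Perm.ModSumCongr (Fin k) (Fin l))) ?_ _ _ ?_ ?_
  · intro i j hij
    by_contra hne
    exact (hclass _ _).1 hij (hinj i j hne)
  · intro q hq
    induction q using Quotient.inductionOn' with | _ τ
    rw [hterm, hzero τ, mul_zero]
    intro i
    by_contra h
    exact hq ⟨i, (hclass _ _).2 h⟩
  · intro i
    exact (hterm _).symm

variable {V : Type*} [AddCommGroup V] [Module ℝ V]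

/-- The `2`-form `β` is diagonal in the frame `(x i 0, x i 1)`: it takes
the value `μ i` on the pair `(x i 0, x i 1)` and vanishes on pairs from different planes. -/
def IsDiagonal {n : ℕ} (β : V [⋀^Fin 2]→ₗ[ℝ] ℝ) (x : Fin n → Fin 2 → V) (μ : Fin n → ℝ) : Prop :=
  ∀ i j a b, β ![x i a, x j b] = if i = j then μ i * (!![0, 1; -1, 0] : Matrix _ _ ℝ) a b else 0

theorem IsDiagonal.comp {n m : ℕ} {β : V [⋀^Fin 2]→ₗ[ℝ] ℝ} {x : Fin n → Fin 2 → V} {μ : Fin n → ℝ}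
    (h : IsDiagonal β x μ) {π : Fin m → Fin n} (hπ : Function.Injective π) :
    IsDiagonal β (x ∘ π) (μ ∘ π) := by
  intro i j a b
  simp only [Function.comp_apply, h (π i) (π j) a b, hπ.eq_iff]

theorem IsDiagonal.self {n : ℕ} {β : V [⋀^Fin 2]→ₗ[ℝ] ℝ} {x : Fin n → Fin 2 → V} {μ : Fin n → ℝ}
    (h : IsDiagonal β x μ) (i : Fin n) : β ![x i 0, x i 1] = μ i := by
  simp [h i i]

/-- Off the pairs `{x i 0, x i 1}` a diagonal form vanishes. -/
theorem IsDiagonal.eq_zero {n : ℕ} {β : V [⋀^Fin 2]→ₗ[ℝ] ℝ} {x : Fin n → Fin 2 → V}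
    {μ : Fin n → ℝ} (h : IsDiagonal β x μ) {p q : Fin n × Fin 2} (hpq : q ≠ (p.1, 1 - p.2)) :
    β ![x p.1 p.2, x q.1 q.2] = 0 := by
  obtain ⟨i, a⟩ := p
  obtain ⟨j, b⟩ := q
  rw [h i j a b]
  split_ifs with hij
  · subst hij
    fin_cases a <;> fin_cases b <;> simp at hpq ⊢
  · rfl

/-- The index of the `m`-th member of the frame `(x 0 0, x 0 1, x 1 0, x 1 1, …)`. -/
def pairIndex (m : ℕ) : Fin 4 × Fin 2 := (Fin.ofNat 4 (m / 2), Fin.ofNat 2 m)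

/-- The tuple `(x 0 0, x 0 1, x 1 0, x 1 1, …)` of the first `k` frame vectors. -/
def frameTuple (x : Fin 4 → Fin 2 → V) (k : ℕ) (m : Fin k) : V :=
  x (pairIndex m).1 (pairIndex m).2

/-- If `β` is diagonal, only those shuffles contribute to `(α ∧ β)(x 0 0, x 0 1, …)` that feed a
whole pair `(x i 0, x i 1)` to `β`. -/
theorem wedge_two_right {k : ℕ} (α : V [⋀^Fin k]→ₗ[ℝ] ℝ)
    {β : V [⋀^Fin 2]→ₗ[ℝ] ℝ}
    {x : Fin 4 → Fin 2 → V} {μ : Fin 4 → ℝ} (hβ : IsDiagonal β x μ)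
    {ι : Type*} [Fintype ι] (σ : ι → Equiv.Perm (Fin k ⊕ Fin 2))
    (hinj : ∀ i j, i ≠ j → ∃ b a, σ j (Sum.inr b) = σ i (Sum.inl a))
    (hcover : ∀ p q : Fin k ⊕ Fin 2,
      pairIndex (finSumFinEquiv q) =
        ((pairIndex (finSumFinEquiv p)).1,
          1 - (pairIndex (finSumFinEquiv p)).2) →
      ∃ i, ∀ a, σ i (Sum.inl a) ≠ p ∧ σ i (Sum.inl a) ≠ q) :
    wedge α β (frameTuple x (k + 2)) = ∑ i, ((Equiv.Perm.sign (σ i) : ℤ) : ℝ) *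
      (α (fun a => frameTuple x (k + 2) (finSumFinEquiv (σ i (Sum.inl a)))) *
        β (fun b => frameTuple x (k + 2) (finSumFinEquiv (σ i (Sum.inr b))))) := by
  refine wedge_apply_eq_sum α β _ σ hinj fun τ hτ => ?_
  have hv : (fun b => frameTuple x (k + 2) (finSumFinEquiv (τ (Sum.inr b)))) =
      ![frameTuple x (k + 2) (finSumFinEquiv (τ (Sum.inr 0))),
        frameTuple x (k + 2) (finSumFinEquiv (τ (Sum.inr 1)))] := by
    funext b
    fin_cases b <;> rfl
  rw [hv]
  unfold frameTuple
  rw [hβ.eq_zero, mul_zero]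
  intro h
  obtain ⟨i, hi⟩ := hcover _ _ h
  obtain ⟨b, a, hba⟩ := hτ i
  fin_cases b
  · exact (hi a).1 hba.symm
  · exact (hi a).2 hba.symm

/-- Exchanges the pair of positions `(p, q)` with the last pair. -/
def pairSwap {k : ℕ} (p q : Fin k) : Equiv.Perm (Fin k ⊕ Fin 2) :=
  Equiv.swap (Sum.inr 0) (Sum.inl p) * Equiv.swap (Sum.inr 1) (Sum.inl q)

theorem sign_pairSwap {k : ℕ} (p q : Fin k) : Equiv.Perm.sign (pairSwap p q) = 1 := by
  simp [pairSwap]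

/-- Exchanges the first pair of positions with the pair `(p, q)`. -/
def pairSwapLeft {k : ℕ} (p q : Fin k) : Equiv.Perm (Fin 2 ⊕ Fin k) :=
  Equiv.swap (Sum.inl 0) (Sum.inr p) * Equiv.swap (Sum.inl 1) (Sum.inr q)

theorem sign_pairSwapLeft {k : ℕ} (p q : Fin k) : Equiv.Perm.sign (pairSwapLeft p q) = 1 := by
  simp [pairSwapLeft]

/-- The length `k` is a variable, here and below, so that the lemma applies to forms on
`Fin (2 + 2)` and the like, and not only to those on a literal. -/
theorem wedge_two_two {k : ℕ} (hk : k = 2) (α : V [⋀^Fin k]→ₗ[ℝ] ℝ) {β : V [⋀^Fin 2]→ₗ[ℝ] ℝ}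
    {x : Fin 4 → Fin 2 → V} {μ : Fin 4 → ℝ} (hβ : IsDiagonal β x μ) :
    wedge α β (frameTuple x (k + 2)) =
      α (frameTuple x k) * μ 1 + α (frameTuple (x ∘ ![1, 0, 2, 3]) k) * μ 0 := by
  subst hk
  refine (wedge_two_right (k := 2) α hβ ![1, pairSwap 0 1]
    (by decide +kernel) (by decide +kernel)).trans ?_
  rw [Fin.sum_univ_two]
  simp only [Matrix.cons_val_zero, Matrix.cons_val_one, sign_pairSwap, map_one, Units.val_one,
    Int.cast_one, one_mul]
  rw [← hβ.self 0, ← hβ.self 1]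
  congr 3 <;> funext a <;> fin_cases a <;> rfl

theorem wedge_four_two {k : ℕ} (hk : k = 4) (α : V [⋀^Fin k]→ₗ[ℝ] ℝ) {β : V [⋀^Fin 2]→ₗ[ℝ] ℝ}
    {x : Fin 4 → Fin 2 → V} {μ : Fin 4 → ℝ} (hβ : IsDiagonal β x μ) :
    wedge α β (frameTuple x (k + 2)) =
      α (frameTuple x k) * μ 2 + α (frameTuple (x ∘ ![2, 1, 0, 3]) k) * μ 0 +
      α (frameTuple (x ∘ ![0, 2, 1, 3]) k) * μ 1 := by
  subst hk
  refine (wedge_two_right (k := 4) α hβ ![1, pairSwap 0 1, pairSwap 2 3]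
    (by decide +kernel) (by decide +kernel)).trans ?_
  rw [Fin.sum_univ_three]
  simp only [Matrix.cons_val_zero, Matrix.cons_val_one, Matrix.cons_val,
    sign_pairSwap, map_one, Units.val_one, Int.cast_one, one_mul]
  rw [← hβ.self 0, ← hβ.self 1, ← hβ.self 2]
  congr 3 <;> congr 1 <;> funext a <;> fin_cases a <;> rfl

theorem wedge_six_two {k : ℕ} (hk : k = 6) (α : V [⋀^Fin k]→ₗ[ℝ] ℝ) {β : V [⋀^Fin 2]→ₗ[ℝ] ℝ}
    {x : Fin 4 → Fin 2 → V} {μ : Fin 4 → ℝ} (hβ : IsDiagonal β x μ) :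
    wedge α β (frameTuple x (k + 2)) =
      α (frameTuple x k) * μ 3 +
      α (frameTuple (x ∘ ![3, 1, 2, 0]) k) * μ 0 +
      α (frameTuple (x ∘ ![0, 3, 2, 1]) k) * μ 1 +
      α (frameTuple (x ∘ ![0, 1, 3, 2]) k) * μ 2 := by
  subst hk
  refine (wedge_two_right (k := 6) α hβ
    ![1, pairSwap 0 1, pairSwap 2 3, pairSwap 4 5] (by decide +kernel) (by decide +kernel)).trans ?_
  rw [Fin.sum_univ_four]
  simp only [Matrix.cons_val_zero, Matrix.cons_val_one, Matrix.cons_val,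
    sign_pairSwap, map_one, Units.val_one, Int.cast_one, one_mul]
  rw [← hβ.self 0, ← hβ.self 1, ← hβ.self 2, ← hβ.self 3]
  congr 4 <;> congr 1 <;> funext a <;> fin_cases a <;> rfl

theorem wedge_two_six {α : V [⋀^Fin 2]→ₗ[ℝ] ℝ} (ψ : V [⋀^Fin 6]→ₗ[ℝ] ℝ)
    {x : Fin 4 → Fin 2 → V} {μ : Fin 4 → ℝ} (hα : IsDiagonal α x μ) :
    wedge α ψ (frameTuple x (2 + 6)) =
      μ 0 * ψ (frameTuple (x ∘ ![1, 2, 3, 0]) 6) +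
      μ 1 * ψ (frameTuple (x ∘ ![0, 2, 3, 1]) 6) +
      μ 2 * ψ (frameTuple (x ∘ ![1, 0, 3, 2]) 6) +
      μ 3 * ψ (frameTuple (x ∘ ![1, 2, 0, 3]) 6) := by
  have hcover : ∀ p q : Fin 2 ⊕ Fin 6, pairIndex (finSumFinEquiv q) =
        ((pairIndex (finSumFinEquiv p)).1, 1 - (pairIndex (finSumFinEquiv p)).2) →
      ∃ i, ∀ a, ![1, pairSwapLeft 0 1, pairSwapLeft 2 3, pairSwapLeft 4 5] i (Sum.inl a) = p ∨
        ![1, pairSwapLeft 0 1, pairSwapLeft 2 3, pairSwapLeft 4 5] i (Sum.inl a) = q := by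
    decide +kernel
  refine (wedge_apply_eq_sum α ψ _ ![1, pairSwapLeft 0 1, pairSwapLeft 2 3, pairSwapLeft 4 5]
    (by decide +kernel) ?_).trans ?_
  · intro τ hτ
    have hv : (fun b => frameTuple x (2 + 6) (finSumFinEquiv (τ (Sum.inl b)))) =
        ![frameTuple x (2 + 6) (finSumFinEquiv (τ (Sum.inl 0))),
          frameTuple x (2 + 6) (finSumFinEquiv (τ (Sum.inl 1)))] := by
      funext b
      fin_cases b <;> rfl
    rw [hv]
    unfold frameTuple
    rw [hα.eq_zero, zero_mul]
    intro h
    obtain ⟨i, hi⟩ := hcover _ _ h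
    obtain ⟨b, a, hba⟩ := hτ i
    rcases hi a with h | h <;> simp [← hba] at h
  · rw [Fin.sum_univ_four]
    simp only [Matrix.cons_val_zero, Matrix.cons_val_one, Matrix.cons_val, sign_pairSwapLeft,
      map_one, Units.val_one, Int.cast_one, one_mul]
    rw [← hα.self 0, ← hα.self 1, ← hα.self 2, ← hα.self 3]
    congr 4 <;> congr 1 <;> funext a <;> fin_cases a <;> rfl

theorem frameTuple_two {V : Type*} (x : Fin 4 → Fin 2 → V) :
    frameTuple x 2 = ![x 0 0, x 0 1] := by
  funext a
  fin_cases a <;> rfl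

/-- The powers of a diagonal form are the elementary symmetric functions of its eigenvalues, up to
factorials. -/
theorem wedge_sq_frame {η : V [⋀^Fin 2]→ₗ[ℝ] ℝ} {x : Fin 4 → Fin 2 → V} {μ : Fin 4 → ℝ}
    (hη : IsDiagonal η x μ) :
    wedge η η (frameTuple x (2 + 2)) = 2 * (μ 0 * μ 1) := by
  refine (wedge_two_two rfl η hη).trans ?_
  rw [frameTuple_two, frameTuple_two, hη.self]
  have h := (hη.comp (π := ![1, 0, 2, 3]) (by decide)).self 0
  rw [h]
  simp only [Function.comp_apply, Matrix.cons_val_zero]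
  ring

theorem wedge_cube_frame {η : V [⋀^Fin 2]→ₗ[ℝ] ℝ} {x : Fin 4 → Fin 2 → V} {μ : Fin 4 → ℝ}
    (hη : IsDiagonal η x μ) :
    wedge (wedge η η) η (frameTuple x (2 + 2 + 2)) =
      6 * (μ 0 * μ 1 * μ 2) := by
  have h1 := wedge_sq_frame hη
  have h2 := wedge_sq_frame (hη.comp (π := ![2, 1, 0, 3]) (by decide))
  have h3 := wedge_sq_frame (hη.comp (π := ![0, 2, 1, 3]) (by decide))
  simp only [Function.comp_apply, Matrix.cons_val_zero, Matrix.cons_val_one] at h2 h3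
  have h := wedge_four_two (k := 2 + 2) rfl (wedge η η) hη
  refine h.trans ?_
  linear_combination μ 2 * h1 + μ 0 * h2 + μ 1 * h3

theorem wedge_fourth_frame {η : V [⋀^Fin 2]→ₗ[ℝ] ℝ} {x : Fin 4 → Fin 2 → V} {μ : Fin 4 → ℝ}
    (hη : IsDiagonal η x μ) :
    wedge (wedge (wedge η η) η) η
        (frameTuple x (2 + 2 + 2 + 2)) =
      24 * (μ 0 * μ 1 * μ 2 * μ 3) := by
  have h1 := wedge_cube_frame hη
  have h2 := wedge_cube_frame (hη.comp (π := ![3, 1, 2, 0]) (by decide))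
  have h3 := wedge_cube_frame (hη.comp (π := ![0, 3, 2, 1]) (by decide))
  have h4 := wedge_cube_frame (hη.comp (π := ![0, 1, 3, 2]) (by decide))
  simp only [Function.comp_apply, Matrix.cons_val_zero, Matrix.cons_val_one,
    Matrix.cons_val] at h2 h3 h4
  have h := wedge_six_two (k := 2 + 2 + 2) rfl (wedge (wedge η η) η) hη
  refine h.trans ?_
  linear_combination μ 3 * h1 + μ 0 * h2 + μ 1 * h3 + μ 2 * h4

/-! ### The Hodge star and the norm in an orthonormal frame -/

/-- A `2`-form as a bilinear map. -/
def _root_.AlternatingMap.toBilin (α : V [⋀^Fin 2]→ₗ[ℝ] ℝ) : V →ₗ[ℝ] V →ₗ[ℝ] ℝ :=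
  LinearMap.mk₂ ℝ (fun v w => α ![v, w]) (fun _ _ _ => α.map_vecCons_add _ _ _)
    (fun _ _ _ => α.map_vecCons_smul _ _ _) (fun v _ _ => (α.curryLeft v).map_vecCons_add _ _ _)
    (fun _ v _ => (α.curryLeft v).map_vecCons_smul _ _ _)

theorem _root_.AlternatingMap.toBilin_apply (α : V [⋀^Fin 2]→ₗ[ℝ] ℝ) (v w : V) :
    α.toBilin v w = α ![v, w] := rfl

section Orthonormal

variable [Module.Finite ℝ V]

theorem bilin_sum_smul {V W κ κ' : Type*} [AddCommGroup V] [Module ℝ V] [AddCommGroup W]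
    [Module ℝ W] [Fintype κ] [Fintype κ'] (B : V →ₗ[ℝ] V →ₗ[ℝ] W) (c : κ → ℝ) (d : κ' → ℝ)
    (v : κ → V) (w : κ' → V) :
    B (∑ i, c i • v i) (∑ j, d j • w j) = ∑ i, ∑ j, (c i * d j) • B (v i) (w j) := by
  simp only [map_sum, map_smul, LinearMap.sum_apply, LinearMap.smul_apply, Finset.smul_sum,
    smul_smul]
  rw [Finset.sum_comm]
  simp only [mul_comm]

open Matrix in
/-- Contracting the raised components of a `2`-form with a bilinear map may be carried out in any
orthonormal basis `e`, where raising indices does nothing. -/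
theorem sum_raise_smul {κ W : Type*} [Fintype κ] [DecidableEq κ] [AddCommGroup W] [Module ℝ W]
    (g : V →ₗ[ℝ] V →ₗ[ℝ] ℝ) (e : Module.Basis κ ℝ V)
    (he : ∀ a b, g (e a) (e b) = if a = b then 1 else 0) (α : V [⋀^Fin 2]→ₗ[ℝ] ℝ)
    (B : V →ₗ[ℝ] V →ₗ[ℝ] W) :
    ∑ i, ∑ j, raise (fun v w => g v w) α i j •
        B (Module.finBasis ℝ V i) (Module.finBasis ℝ V j) =
      ∑ a, ∑ b, α ![e a, e b] • B (e a) (e b) := by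
  set b := Module.finBasis ℝ V with hb
  -- `P` expresses `b` in terms of `e`, and `Q` is its inverse.
  set P : Matrix κ _ ℝ := e.toMatrix b with hP
  set Q : Matrix _ κ ℝ := b.toMatrix e with hQ
  have hPQ : P * Q = 1 := e.toMatrix_mul_toMatrix_flip b
  have hQP : Q * P = 1 := b.toMatrix_mul_toMatrix_flip e
  have hbe : ∀ i, b i = ∑ a, P a i • e a := fun i => (e.sum_toMatrix_smul_self b i).symm
  have heb : ∀ a, e a = ∑ i, Q i a • b i := fun a => (b.sum_toMatrix_smul_self e a).symm
  have hG : (Matrix.of fun i j => g (b i) (b j)) = Pᵀ * P := by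
    ext i j
    simp only [Matrix.of_apply, hbe, map_sum, map_smul, LinearMap.sum_apply, LinearMap.smul_apply,
      he, smul_eq_mul, Matrix.mul_apply, Matrix.transpose_apply]
    simp [mul_comm]
  have hinv : invGram (fun v w => g v w) = Q * Qᵀ := by
    rw [invGram]
    refine Matrix.inv_eq_left_inv ?_
    rw [hG, ← Matrix.mul_assoc, Matrix.mul_assoc Q, ← Matrix.transpose_mul, hPQ,
      Matrix.transpose_one, Matrix.mul_one, hQP]
  have hdual : ∀ i, ∑ k, invGram (fun v w => g v w) i k • b k = ∑ a, Q i a • e a := by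
    intro i
    simp only [hinv, Matrix.mul_apply, Matrix.transpose_apply, Finset.sum_smul, heb,
      Finset.smul_sum, smul_smul]
    exact Finset.sum_comm
  have hraise : ∀ i j, raise (fun v w => g v w) α i j =
      ∑ a, ∑ c, Q i a * Q j c * α ![e a, e c] := by
    intro i j
    have h1 : raise (fun v w => g v w) α i j =
        α.toBilin (∑ k, invGram (fun v w => g v w) i k • b k)
          (∑ l, invGram (fun v w => g v w) j l • b l) := by
      rw [bilin_sum_smul]
      rfl
    rw [h1, hdual, hdual]
    rw [bilin_sum_smul]
    rfl
  have hB : ∀ a c, B (e a) (e c) = ∑ i, ∑ j, (Q i a * Q j c) • B (b i) (b j) := by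
    intro a c
    conv_lhs => rw [heb a, heb c]
    exact bilin_sum_smul B _ _ _ _
  simp only [hraise, hB, Finset.sum_smul, Finset.smul_sum, smul_smul]
  have hcomm : ∀ f : Fin (Module.finrank ℝ V) → Fin (Module.finrank ℝ V) → κ → κ → W,
      ∑ i, ∑ j, ∑ a, ∑ c, f i j a c = ∑ a, ∑ c, ∑ i, ∑ j, f i j a c := by
    intro f
    calc ∑ i, ∑ j, ∑ a, ∑ c, f i j a c = ∑ i, ∑ a, ∑ j, ∑ c, f i j a c :=
          Finset.sum_congr rfl fun i _ => Finset.sum_comm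
      _ = ∑ a, ∑ i, ∑ c, ∑ j, f i j a c :=
          Finset.sum_comm.trans (Finset.sum_congr rfl fun a _ => Finset.sum_congr rfl
            fun i _ => Finset.sum_comm)
      _ = ∑ a, ∑ c, ∑ i, ∑ j, f i j a c := Finset.sum_congr rfl fun a _ => Finset.sum_comm
  rw [hcomm]
  refine Finset.sum_congr rfl fun a _ => Finset.sum_congr rfl fun c _ =>
    Finset.sum_congr rfl fun i _ => Finset.sum_congr rfl fun j _ => ?_
  congr 1
  ring

/-- In a unitary frame the squared norm of a diagonal `2`-form is the sum of the squares of its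
eigenvalues. -/
theorem formNormSq_frame {x : Fin 4 → Fin 2 → V} {μ : Fin 4 → ℝ} (g : V →ₗ[ℝ] V →ₗ[ℝ] ℝ)
    (e : Module.Basis (Fin 4 × Fin 2) ℝ V) (hex : ∀ p, e p = x p.1 p.2)
    (he : ∀ a b, g (e a) (e b) = if a = b then 1 else 0) {α : V [⋀^Fin 2]→ₗ[ℝ] ℝ}
    (hα : IsDiagonal α x μ) :
    formNormSq (fun v w => g v w) α = ∑ i, μ i ^ 2 := by
  have h := sum_raise_smul g e he α α.toBilin
  simp only [AlternatingMap.toBilin_apply, smul_eq_mul] at h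
  rw [formNormSq, h]
  simp only [hex, Fintype.sum_prod_type, hα _ _ _ _, Fin.sum_univ_two]
  simp only [mul_ite, ite_mul, zero_mul, Finset.sum_add_distrib, Finset.sum_ite_eq, Finset.mem_univ,
    if_true, Matrix.of_apply, Matrix.cons_val_zero, Matrix.cons_val_one, Matrix.cons_val',
    Matrix.cons_val_fin_one, mul_zero, zero_add, add_zero, ite_self]
  rw [← Finset.sum_add_distrib, Finset.mul_sum]
  exact Finset.sum_congr rfl fun i _ => by ring

/-- The Hodge star of a diagonal `2`-form contracts the volume form with the pairs of the
frame. -/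
theorem hodgeStar_frame {x : Fin 4 → Fin 2 → V} {μ : Fin 4 → ℝ} (g : V →ₗ[ℝ] V →ₗ[ℝ] ℝ)
    (e : Module.Basis (Fin 4 × Fin 2) ℝ V) (hex : ∀ p, e p = x p.1 p.2)
    (he : ∀ a b, g (e a) (e b) = if a = b then 1 else 0) (vol : V [⋀^Fin 8]→ₗ[ℝ] ℝ)
    {α : V [⋀^Fin 2]→ₗ[ℝ] ℝ} (hα : IsDiagonal α x μ) (v : Fin 6 → V) :
    hodgeStar (fun v w => g v w) vol α v =
      ∑ i, μ i * vol (Matrix.vecCons (x i 0) (Matrix.vecCons (x i 1) v)) := by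
  let B : V →ₗ[ℝ] V →ₗ[ℝ] V [⋀^Fin 6]→ₗ[ℝ] ℝ :=
    (AlternatingMap.curryLeftLinearMap).comp vol.curryLeft
  let ev : (V [⋀^Fin 6]→ₗ[ℝ] ℝ) →ₗ[ℝ] ℝ :=
    { toFun := fun f => f v, map_add' := fun _ _ => rfl, map_smul' := fun _ _ => rfl }
  have h := congrArg (fun f => (1 / 2 : ℝ) * ev f) (sum_raise_smul g e he α B)
  refine h.trans ?_
  have hanti : ∀ p q : V, vol (Matrix.vecCons q (Matrix.vecCons p v)) =
      -vol (Matrix.vecCons p (Matrix.vecCons q v)) := by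
    intro p q
    have h := vol.map_swap (Matrix.vecCons p (Matrix.vecCons q v))
      (i := 0) (j := 1) (by decide)
    rw [← h]
    congr 1
    funext i
    refine Fin.cases ?_ (fun i => Fin.cases ?_ (fun i => ?_) i) i
    · rfl
    · rfl
    · have : Equiv.swap (0 : Fin 8) 1 i.succ.succ = i.succ.succ :=
        Equiv.swap_apply_of_ne_of_ne (Fin.succ_ne_zero _)
          (fun h => Fin.succ_ne_zero i (Fin.succ_injective _ h))
      simp only [Function.comp_apply, this]
      rfl
  have hBv : ∀ a c, ev (B (e a) (e c)) =
      vol (Matrix.vecCons (x a.1 a.2) (Matrix.vecCons (x c.1 c.2) v)) := by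
    intro a c
    rw [← hex, ← hex]
    rfl
  simp only [map_sum, map_smul, hBv, smul_eq_mul]
  simp only [hex, Fintype.sum_prod_type, hα _ _ _ _, Fin.sum_univ_two]
  simp only [ite_mul, zero_mul, Finset.sum_add_distrib, Finset.sum_ite_eq, Finset.mem_univ,
    if_true, Matrix.of_apply, Matrix.cons_val_zero, Matrix.cons_val_one, Matrix.cons_val',
    Matrix.cons_val_fin_one, mul_zero, zero_add, add_zero, ite_self]
  rw [← Finset.sum_add_distrib, Finset.mul_sum]
  refine Finset.sum_congr rfl fun i _ => ?_
  rw [hanti (x i 0) (x i 1)]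
  ring

end Orthonormal

/-! ### The trace of a diagonal form -/

/-- `η⁴ / 4!` takes the value `1` on every reordering of a unitary frame of `η`. -/
theorem volume_frame {η : V [⋀^Fin 2]→ₗ[ℝ] ℝ} {x : Fin 4 → Fin 2 → V}
    (hη : IsDiagonal η x fun _ => 1) {π : Fin 4 → Fin 4} (hπ : Function.Injective π) :
    ((1 / 24 : ℝ) • wedge (wedge (wedge η η) η) η) (frameTuple (x ∘ π) (2 + 2 + 2 + 2)) = 1 := by
  have h := wedge_fourth_frame (hη.comp hπ)
  change (1 / 24 : ℝ) * wedge (wedge (wedge η η) η) η (frameTuple (x ∘ π) (2 + 2 + 2 + 2)) = 1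
  rw [h]
  simp

/-- `½ η² + ρ` takes the value `1` on two pairs of a unitary frame on which `ρ` vanishes. -/
theorem half_sq_add_frameTuple {x : Fin 4 → Fin 2 → V} {η : V [⋀^Fin 2]→ₗ[ℝ] ℝ}
    (hη : IsDiagonal η x fun _ => 1) {ρ : V [⋀^Fin 4]→ₗ[ℝ] ℝ} {π : Fin 4 → Fin 4}
    (hπ : Function.Injective π) (hρ : ρ (frameTuple (x ∘ π) 4) = 0) :
    ((1 / 2 : ℝ) • wedge η η + ρ) (frameTuple (x ∘ π) 4) = 1 := by
  have h := wedge_sq_frame (hη.comp hπ)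
  change (1 / 2 : ℝ) * wedge η η (frameTuple (x ∘ π) (2 + 2)) + ρ (frameTuple (x ∘ π) 4) = 1
  rw [h, hρ]
  simp

variable [Module.Finite ℝ V]

/-- On three of the four pairs of a unitary frame, the Hodge star of a diagonal form gives the
eigenvalue of the remaining pair. -/
theorem hodgeStar_frameTuple {x : Fin 4 → Fin 2 → V} {μ : Fin 4 → ℝ} (g : V →ₗ[ℝ] V →ₗ[ℝ] ℝ)
    (e : Module.Basis (Fin 4 × Fin 2) ℝ V) (hex : ∀ p, e p = x p.1 p.2)
    (he : ∀ a b, g (e a) (e b) = if a = b then 1 else 0) {vol : V [⋀^Fin 8]→ₗ[ℝ] ℝ}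
    (hvol : ∀ π : Fin 4 → Fin 4, Function.Injective π → vol (frameTuple (x ∘ π) 8) = 1)
    {α : V [⋀^Fin 2]→ₗ[ℝ] ℝ} (hα : IsDiagonal α x μ) {π : Fin 4 → Fin 4}
    (hπ : Function.Injective π) :
    hodgeStar (fun v w => g v w) vol α (frameTuple (x ∘ π) 6) = μ (π 3) := by
  rw [hodgeStar_frame g e hex he vol hα, Finset.sum_eq_single (π 3)]
  · have h : Matrix.vecCons (x (π 3) 0) (Matrix.vecCons (x (π 3) 1) (frameTuple (x ∘ π) 6)) =
        frameTuple (x ∘ (π ∘ ![3, 0, 1, 2])) 8 := by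
      funext i
      fin_cases i <;> rfl
    rw [h, hvol _ (hπ.comp (by decide)), mul_one]
  · intro i _ hi
    -- `i` is one of the pairs already present, so the volume form has a repeated argument.
    obtain ⟨j, rfl⟩ := (Finite.injective_iff_surjective.1 hπ) i
    have hj : j ≠ 3 := fun h => hi (by rw [h])
    have : ∃ l : Fin 8, l ≠ 0 ∧ Matrix.vecCons (x (π j) 0)
        (Matrix.vecCons (x (π j) 1) (frameTuple (x ∘ π) 6)) l = x (π j) 0 := by
      fin_cases j
      · exact ⟨2, by decide, rfl⟩
      · exact ⟨4, by decide, rfl⟩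
      · exact ⟨6, by decide, rfl⟩
      · exact absurd rfl hj
    obtain ⟨l, hl, hx⟩ := this
    rw [vol.map_eq_zero_of_eq _ (i := l) (j := 0) (hx.trans rfl) hl, mul_zero]
  · simp

/-- The equation `α ∧ ⋆η = 0` says that the trace of `α` with respect to `η` vanishes. -/
theorem trace_eq_zero_of_wedge_hodgeStar {x : Fin 4 → Fin 2 → V} {μ : Fin 4 → ℝ}
    (g : V →ₗ[ℝ] V →ₗ[ℝ] ℝ)
    (e : Module.Basis (Fin 4 × Fin 2) ℝ V) (hex : ∀ p, e p = x p.1 p.2)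
    (he : ∀ a b, g (e a) (e b) = if a = b then 1 else 0) {η : V [⋀^Fin 2]→ₗ[ℝ] ℝ}
    (hη : IsDiagonal η x fun _ => 1) {vol : V [⋀^Fin 8]→ₗ[ℝ] ℝ}
    (hvol : ∀ π : Fin 4 → Fin 4, Function.Injective π → vol (frameTuple (x ∘ π) 8) = 1)
    {α : V [⋀^Fin 2]→ₗ[ℝ] ℝ} (hα : IsDiagonal α x μ)
    (h : wedge α (hodgeStar (fun v w => g v w) vol η) = 0) : ∑ i, μ i = 0 := by
  have h1 := wedge_two_six (hodgeStar (fun v w => g v w) vol η) hα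
  rw [h, AlternatingMap.zero_apply] at h1
  have hs := fun (π : Fin 4 → Fin 4) hπ =>
    hodgeStar_frameTuple g e hex he hvol hη (π := π) hπ
  rw [hs _ (by decide), hs _ (by decide), hs _ (by decide), hs _ (by decide)] at h1
  rw [Fin.sum_univ_four]
  linarith

/-- The equation `⋆α = -Φ ∧ α` forces the trace of `α` to vanish, if the `4`-form `Φ` takes the
value `1` on any two pairs of the frame. -/
theorem trace_eq_zero_of_hodgeStar_eq {x : Fin 4 → Fin 2 → V} {μ : Fin 4 → ℝ}
    (g : V →ₗ[ℝ] V →ₗ[ℝ] ℝ)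
    (e : Module.Basis (Fin 4 × Fin 2) ℝ V) (hex : ∀ p, e p = x p.1 p.2)
    (he : ∀ a b, g (e a) (e b) = if a = b then 1 else 0) {vol : V [⋀^Fin 8]→ₗ[ℝ] ℝ}
    (hvol : ∀ π : Fin 4 → Fin 4, Function.Injective π → vol (frameTuple (x ∘ π) 8) = 1)
    {α : V [⋀^Fin 2]→ₗ[ℝ] ℝ} (hα : IsDiagonal α x μ) {Φ : V [⋀^Fin 4]→ₗ[ℝ] ℝ}
    (hΦ : ∀ π : Fin 4 → Fin 4, Function.Injective π → Φ (frameTuple (x ∘ π) 4) = 1)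
    (h : hodgeStar (fun v w => g v w) vol α = -wedge Φ α) : ∑ i, μ i = 0 := by
  have h1 := wedge_four_two rfl Φ hα
  have h3 : hodgeStar (fun v w => g v w) vol α (frameTuple x (4 + 2)) = μ 3 :=
    hodgeStar_frameTuple g e hex he hvol hα (π := id) Function.injective_id
  rw [h, AlternatingMap.neg_apply] at h3
  have hid := hΦ id Function.injective_id
  rw [Function.comp_id] at hid
  replace h3 : -(wedge Φ α (frameTuple x (4 + 2))) = μ 3 := h3
  rw [h1, hid, hΦ _ (by decide), hΦ _ (by decide)] at h3
  rw [Fin.sum_univ_four]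
  linarith

end Algebra

/-! ### Exterior derivatives of radial forms -/

/-- Linear functionals as `1`-forms. -/
def toForm : (E →L[ℝ] ℝ) ≃ₗᵢ[ℝ] (E [⋀^Fin 1]→L[ℝ] ℝ) :=
  ContinuousAlternatingMap.ofSubsingletonLIE (0 : Fin 1)

theorem toForm_symm_apply (α : E [⋀^Fin 1]→L[ℝ] ℝ) (v : E) : toForm.symm α v = α ![v] := by
  conv_rhs => rw [← toForm.apply_symm_apply α]
  rfl

theorem extDeriv_apply_pair {a : OneForm} {z : E} (ha : DifferentiableAt ℝ a z) (v w : E) :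
    extDeriv a z ![v, w] = fderiv ℝ a z v ![w] - fderiv ℝ a z w ![v] := by
  have h : ∀ u v' : E, fderiv ℝ (fun y => a y ![u]) z v' = fderiv ℝ a z v' ![u] := by
    intro u v'
    rw [fderiv_continuousAlternatingMap_apply_const ha]
    rfl
  have h0 : (0 : Fin 2).removeNth ![v, w] = ![w] := by
    funext i; fin_cases i; rfl
  have h1 : (1 : Fin 2).removeNth ![v, w] = ![v] := by
    funext i; fin_cases i; rfl
  rw [extDeriv_apply ha, Fin.sum_univ_two, h0, h1, h, h]
  simp [sub_eq_add_neg]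

/-- The standard hermitian product of `ℂ⁵`, conjugate-linear in the first argument. -/
def herm (v w : E) : ℂ := ∑ j, (starRingEnd ℂ) (v j) * w j

/-- The complex bilinear form `∑ vⱼ wⱼ` defining the quadric. -/
def bil (v w : E) : ℂ := ∑ j, v j * w j

theorem herm_add_right (v w w' : E) : herm v (w + w') = herm v w + herm v w' := by
  simp [herm, mul_add, Finset.sum_add_distrib]

theorem herm_add_left (v v' w : E) : herm (v + v') w = herm v w + herm v' w := by
  simp [herm, add_mul, Finset.sum_add_distrib]

theorem herm_smul_right (c : ℂ) (v w : E) : herm v (c • w) = c * herm v w := by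
  simp only [herm, Finset.mul_sum, Pi.smul_apply, smul_eq_mul]
  exact Finset.sum_congr rfl fun _ _ => by ring

theorem herm_smul_left (c : ℂ) (v w : E) : herm (c • v) w = (starRingEnd ℂ) c * herm v w := by
  simp only [herm, Finset.mul_sum, Pi.smul_apply, smul_eq_mul, map_mul]
  exact Finset.sum_congr rfl fun _ _ => by ring

theorem herm_conj (v w : E) : (starRingEnd ℂ) (herm v w) = herm w v := by
  simp only [herm, map_sum, map_mul, Complex.conj_conj]
  exact Finset.sum_congr rfl fun _ _ => by ring

theorem herm_self (z : E) : herm z z = (radiusSq z : ℂ) := by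
  simp [herm, radiusSq, Complex.normSq_eq_conj_mul_self]

theorem smul_eq_ofReal_smul (c : ℝ) (v : E) : c • v = (c : ℂ) • v := by
  funext j
  simp

/-- `Re ⟨v, w⟩`, the Euclidean inner product of `ℝ¹⁰ = ℂ⁵`. -/
def reL : E →L[ℝ] E →L[ℝ] ℝ :=
  (LinearMap.mk₂ ℝ (fun v w => (herm v w).re)
    (fun v v' w => by simp [herm_add_left])
    (fun c v w => by rw [smul_eq_ofReal_smul, herm_smul_left]; simp)
    (fun v w w' => by simp [herm_add_right])
    (fun c v w => by rw [smul_eq_ofReal_smul, herm_smul_right]; simp)).toContinuousBilinearMap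

/-- `Im ⟨v, w⟩ = ∑ (dxʲ ∧ dyʲ)(v, w)`. -/
def imL : E →L[ℝ] E →L[ℝ] ℝ :=
  (LinearMap.mk₂ ℝ (fun v w => (herm v w).im)
    (fun v v' w => by simp [herm_add_left])
    (fun c v w => by rw [smul_eq_ofReal_smul, herm_smul_left]; simp)
    (fun v w w' => by simp [herm_add_right])
    (fun c v w => by rw [smul_eq_ofReal_smul, herm_smul_right]; simp)).toContinuousBilinearMap

theorem reL_apply (v w : E) : reL v w = (herm v w).re := rfl

theorem imL_apply (v w : E) : imL v w = (herm v w).im := rfl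

theorem reL_symm (v w : E) : reL v w = reL w v := by
  rw [reL_apply, reL_apply, ← herm_conj w v, Complex.conj_re]

theorem imL_antisymm (v w : E) : imL v w = -imL w v := by
  rw [imL_apply, imL_apply, ← herm_conj w v, Complex.conj_im]

theorem radiusSq_eq (z : E) : radiusSq z = reL z z := by
  rw [reL_apply, herm_self, Complex.ofReal_re]

theorem hasFDerivAt_radiusSq (z : E) : HasFDerivAt radiusSq ((2 : ℝ) • reL z) z := by
  have h : HasFDerivAt (fun w => reL w w) _ z := reL.hasFDerivAt.clm_apply (hasFDerivAt_id z)
  have h' : radiusSq = fun w => reL w w := funext radiusSq_eq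
  rw [h']
  refine h.congr_fderiv ?_
  ext v
  simp [reL_symm v z, two_mul]

theorem radiusSq_nonneg (z : E) : 0 ≤ radiusSq z :=
  Finset.sum_nonneg fun _ _ => Complex.normSq_nonneg _

/-- The exterior derivative of `f(r²) ⟨L z, ·⟩` for a bilinear form `L`. -/
theorem extDeriv_radial (L : E →L[ℝ] E →L[ℝ] ℝ) {f : ℝ → ℝ} {f' : ℝ} {z : E}
    (hf : HasDerivAt f f' (radiusSq z)) :
    DifferentiableAt ℝ (fun w => toForm (f (radiusSq w) • L w)) z ∧
    ∀ v w : E, extDeriv (fun w => toForm (f (radiusSq w) • L w)) z ![v, w] =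
      2 * f' * (reL z v * L z w - reL z w * L z v) + f (radiusSq z) * (L v w - L w v) := by
  have h1 : HasFDerivAt (fun w => f (radiusSq w)) (f' • ((2 : ℝ) • reL z)) z :=
    hf.comp_hasFDerivAt z (hasFDerivAt_radiusSq z)
  have h2 := h1.smul (L.hasFDerivAt (x := z))
  have h3 : HasFDerivAt (fun w => toForm (f (radiusSq w) • L w)) _ z :=
    (toForm.toContinuousLinearEquiv : (E →L[ℝ] ℝ) →L[ℝ] (E [⋀^Fin 1]→L[ℝ] ℝ)).hasFDerivAt.comp z h2
  refine ⟨h3.differentiableAt, fun v w => ?_⟩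
  rw [extDeriv_apply_pair h3.differentiableAt, h3.fderiv]
  simp only [ContinuousLinearMap.comp_apply]
  change (f (radiusSq z) * L v w + f' * (2 * reL z v) * L z w) -
    (f (radiusSq z) * L w v + f' * (2 * reL z w) * L z v) = _
  ring

/-! ### The Kähler form -/

/-- The derivative `𝓕'` of the Kähler potential. -/
def kp (t : ℝ) : ℝ :=
  (4 / 3 : ℝ) ^ (1 / 4 : ℝ) * (t + 2) ^ (1 / 4 : ℝ) * (t + 1) ^ (-(1 / 2) : ℝ)

theorem kp_pos {t : ℝ} (ht : -1 < t) : 0 < kp t := by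
  have h1 : 0 < t + 2 := by linarith
  have h2 : 0 < t + 1 := by linarith
  unfold kp
  positivity

theorem kp_one : kp 1 = 1 := by
  have h3 : (4 / 3 : ℝ) ^ (1 / 4 : ℝ) * (3 : ℝ) ^ (1 / 4 : ℝ) = (2 : ℝ) ^ (1 / 2 : ℝ) := by
    rw [← Real.mul_rpow (by norm_num) (by norm_num)]
    rw [show (4 / 3 * 3 : ℝ) = (2 : ℝ) ^ (2 : ℝ) by norm_num, ← Real.rpow_mul (by norm_num)]
    norm_num
  have h : kp 1 = (4 / 3 : ℝ) ^ (1 / 4 : ℝ) * (3 : ℝ) ^ (1 / 4 : ℝ) * (2 : ℝ) ^ (-(1 / 2) : ℝ) := by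
    unfold kp
    norm_num
  rw [h, h3, ← Real.rpow_add (by norm_num)]
  norm_num

/-- The logarithmic derivative of `𝓕'`. -/
theorem hasDerivAt_kp {t : ℝ} (ht : -1 < t) :
    HasDerivAt kp (kp t * (1 / (4 * (t + 2)) - 1 / (2 * (t + 1)))) t := by
  have h1 : 0 < t + 2 := by linarith
  have h2 : 0 < t + 1 := by linarith
  have d1 := ((hasDerivAt_id t).add_const 2).rpow_const (p := (1 / 4 : ℝ)) (Or.inl h1.ne')
  have d2 := ((hasDerivAt_id t).add_const 1).rpow_const (p := (-(1 / 2) : ℝ)) (Or.inl h2.ne')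
  refine ((d1.const_mul ((4 / 3 : ℝ) ^ (1 / 4 : ℝ))).mul d2).congr_deriv ?_
  simp only [id_eq]
  rw [Real.rpow_sub_one h1.ne', Real.rpow_sub_one h2.ne']
  unfold kp
  field_simp
  ring

theorem continuousOn_kp : ContinuousOn kp (Ioi (-1)) := fun _ ht =>
  (hasDerivAt_kp ht).continuousAt.continuousWithinAt

theorem hasDerivAt_potential {t : ℝ} (ht : -1 < t) : HasDerivAt potential (kp t) t := by
  have hsub : uIcc 1 t ⊆ Ioi (-1) := by
    intro s hs
    rcases mem_uIcc.1 hs with h | h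
    · exact lt_of_lt_of_le (by norm_num) h.1
    · exact lt_of_lt_of_le ht h.1
  exact intervalIntegral.integral_hasDerivAt_right
    ((continuousOn_kp.mono hsub).intervalIntegrable)
    (continuousOn_kp.stronglyMeasurableAtFilter isOpen_Ioi t ht)
    (hasDerivAt_kp ht).continuousAt

/-- The real `(1,1)`-form `p ∂t ∧ ∂̄t + q ∂∂̄t` up to normalisation: both the Kähler form and
the curvature of an invariant connection have this shape. -/
def radialTwoForm (p q : ℝ) (z v w : E) : ℝ :=
  p * (reL z v * imL z w - reL z w * imL z v) + q * imL v w

theorem potentialForm_eq : potentialForm =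
    fun w => toForm (((fun t => -2 * kp t) (radiusSq w)) • imL w) := by
  funext w
  have h : HasFDerivAt (fun w => potential (radiusSq w)) (kp (radiusSq w) • ((2 : ℝ) • reL w)) w :=
    (hasDerivAt_potential (by linarith [radiusSq_nonneg w])).comp_hasFDerivAt w
      (hasFDerivAt_radiusSq w)
  change toForm _ = toForm _
  rw [h.fderiv]
  congr 1
  ext v
  have h2 : reL w (J v) = -imL w v := by
    rw [reL_apply, imL_apply]
    change (herm w (Complex.I • v)).re = _
    rw [herm_smul_right]
    simp
  simp [h2]
  ring

theorem kahlerAmbient_apply (z v w : E) : kahlerAmbient z ![v, w] =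
    radialTwoForm (deriv kp (radiusSq z)) (kp (radiusSq z)) z v w := by
  have hz : -1 < radiusSq z := by linarith [radiusSq_nonneg z]
  have h := (extDeriv_radial imL ((hasDerivAt_kp hz).const_mul (-2))).2 v w
  rw [← potentialForm_eq] at h
  change (-(1 / 4) : ℝ) * extDeriv potentialForm z ![v, w] = _
  rw [h, (hasDerivAt_kp hz).deriv, imL_antisymm w v, radialTwoForm]
  ring

/-! ### The action of the orthogonal group -/

theorem act_apply (h : Matrix (Fin 5) (Fin 5) ℝ) (v : E) (i : Fin 5) :
    act h v i = ∑ j, (h i j : ℂ) * v j := rfl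

theorem act_smul (h : Matrix (Fin 5) (Fin 5) ℝ) (c : ℂ) (v : E) :
    act h (c • v) = c • act h v := by
  funext i
  simp only [act_apply, Pi.smul_apply, smul_eq_mul, Finset.mul_sum]
  exact Finset.sum_congr rfl fun _ _ => by ring

theorem transpose_mul_self_of_mem {h : Matrix (Fin 5) (Fin 5) ℝ}
    (hh : h ∈ Matrix.specialOrthogonalGroup (Fin 5) ℝ) (j k : Fin 5) :
    ∑ i, h i j * h i k = if j = k then 1 else 0 := by
  have h1 := (Matrix.mem_orthogonalGroup_iff' (Fin 5) ℝ).1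
    (Matrix.mem_specialOrthogonalGroup_iff.1 hh).1
  have h2 := congrFun (congrFun h1 j) k
  simpa [Matrix.mul_apply, Matrix.one_apply, Matrix.star_apply] using h2

theorem bil_act {h : Matrix (Fin 5) (Fin 5) ℝ}
    (hh : h ∈ Matrix.specialOrthogonalGroup (Fin 5) ℝ) (v w : E) :
    bil (act h v) (act h w) = bil v w := by
  simp only [bil, act_apply, Finset.sum_mul_sum]
  rw [Finset.sum_comm]
  refine Finset.sum_congr rfl fun j _ => ?_
  rw [Finset.sum_comm]
  have : ∀ k, ∑ i, (h i j : ℂ) * v j * ((h i k : ℂ) * w k) =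
      ((∑ i, h i j * h i k : ℝ) : ℂ) * (v j * w k) := by
    intro k
    rw [Complex.ofReal_sum, Finset.sum_mul]
    exact Finset.sum_congr rfl fun i _ => by push_cast; ring
  simp only [this, transpose_mul_self_of_mem hh]
  rw [Finset.sum_eq_single j (fun k _ hk => by simp [Ne.symm hk]) (by simp)]
  simp

theorem herm_act {h : Matrix (Fin 5) (Fin 5) ℝ}
    (hh : h ∈ Matrix.specialOrthogonalGroup (Fin 5) ℝ) (v w : E) :
    herm (act h v) (act h w) = herm v w := by
  have h1 : ∀ v w : E, herm v w = bil (fun j => (starRingEnd ℂ) (v j)) w := fun v w => rfl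
  have h2 : (fun j => (starRingEnd ℂ) (act h v j)) = act h fun j => (starRingEnd ℂ) (v j) := by
    funext j
    simp [act_apply]
  rw [h1, h1, h2, bil_act hh]

theorem radiusSq_act {h : Matrix (Fin 5) (Fin 5) ℝ}
    (hh : h ∈ Matrix.specialOrthogonalGroup (Fin 5) ℝ) (v : E) :
    radiusSq (act h v) = radiusSq v := by
  have h1 := herm_act hh v v
  rw [herm_self, herm_self] at h1
  exact_mod_cast h1

theorem mem_X_iff {z : E} : z ∈ X ↔ bil z z = 1 := by
  simp only [X, bil, mem_ofPred_eq, sq]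

theorem mem_tangent_iff {z v : E} : v ∈ tangent z ↔ bil z v = 0 := Iff.rfl

/-! ### A retraction onto the quadric -/

/-- `∑ vⱼ wⱼ` as a continuous real bilinear map. -/
def bilL : E →L[ℝ] E →L[ℝ] ℂ :=
  (LinearMap.mk₂ ℝ bil
    (fun v v' w => by simp [bil, add_mul, Finset.sum_add_distrib])
    (fun c v w => by simp [bil, mul_assoc, Finset.mul_sum])
    (fun v w w' => by simp [bil, mul_add, Finset.sum_add_distrib])
    (fun c v w => by simp [bil, Finset.mul_sum, mul_left_comm])).toContinuousBilinearMap

theorem bilL_apply (v w : E) : bilL v w = bil v w := rfl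

theorem bil_symm (v w : E) : bil v w = bil w v :=
  Finset.sum_congr rfl fun _ _ => mul_comm _ _

theorem bil_smul_right (c : ℂ) (v w : E) : bil v (c • w) = c * bil v w := by
  simp only [bil, Finset.mul_sum, Pi.smul_apply, smul_eq_mul]
  exact Finset.sum_congr rfl fun _ _ => by ring

/-- The open set `{∑ zⱼ² ∉ (-∞, 0]}`, a neighbourhood of the quadric. -/
def domain : Set E := {z | bil z z ∈ Complex.slitPlane}

/-- The retraction `z ↦ z / √(∑ zⱼ²)` of `domain` onto the quadric, written with the principal
branch of the logarithm. -/
def retract (z : E) : E := Complex.exp (-(1 / 2) * Complex.log (bil z z)) • z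

theorem contDiff_bil_self : ContDiff ℝ ∞ fun z : E => bil z z :=
  (bilL.contDiff.clm_apply contDiff_id : ContDiff ℝ ∞ fun z : E => bilL z z)

theorem isOpen_domain : IsOpen domain :=
  Complex.isOpen_slitPlane.preimage contDiff_bil_self.continuous

theorem X_subset_domain : X ⊆ domain := by
  intro z hz
  change bil z z ∈ Complex.slitPlane
  rw [mem_X_iff.1 hz]
  exact Complex.one_mem_slitPlane

theorem retract_of_mem {z : E} (hz : z ∈ X) : retract z = z := by
  simp [retract, mem_X_iff.1 hz]

theorem retract_mem {z : E} (hz : z ∈ domain) : retract z ∈ X := by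
  have h0 : bil z z ≠ 0 := Complex.slitPlane_ne_zero hz
  rw [mem_X_iff, retract, bil_smul_right, bil_symm (_ • z) z, bil_smul_right, ← mul_assoc,
    ← Complex.exp_add, show -(1 / 2) * Complex.log (bil z z) + -(1 / 2) * Complex.log (bil z z) =
    -Complex.log (bil z z) by ring, Complex.exp_neg, Complex.exp_log h0, inv_mul_cancel₀ h0]

theorem retract_act {h : Matrix (Fin 5) (Fin 5) ℝ}
    (hh : h ∈ Matrix.specialOrthogonalGroup (Fin 5) ℝ) (z : E) :
    retract (act h z) = act h (retract z) := by
  rw [retract, retract, bil_act hh, act_smul]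

theorem contDiffOn_retract : ContDiffOn ℝ ∞ retract domain := by
  intro z hz
  refine ContDiffAt.contDiffWithinAt ?_
  have h1 : ContDiffAt ℂ ∞ (fun q : ℂ => Complex.exp (-(1 / 2) * Complex.log q)) (bil z z) :=
    (contDiffAt_const.mul (Complex.contDiffAt_log hz)).cexp
  exact (ContDiffAt.comp (f := fun z : E => bil z z) z (h1.restrict_scalars ℝ)
    contDiff_bil_self.contDiffAt).smul contDiffAt_id

theorem contDiffAt_retract {z : E} (hz : z ∈ domain) : ContDiffAt ℝ ∞ retract z :=
  contDiffOn_retract.contDiffAt (isOpen_domain.mem_nhds hz)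

theorem hasFDerivAt_bil_self (z : E) :
    HasFDerivAt (fun w : E => bil w w) ((2 : ℝ) • bilL z) z := by
  have h : HasFDerivAt (fun w => bilL w w) _ z := bilL.hasFDerivAt.clm_apply (hasFDerivAt_id z)
  refine HasFDerivAt.congr_fderiv (f := fun w => bilL w w) h ?_
  ext v
  simp [bilL_apply, bil_symm v z, two_mul]

/-- The retraction maps into the quadric, so its differential maps to the tangent spaces. -/
theorem fderiv_retract_mem {z : E} (hz : z ∈ domain) (v : E) :
    fderiv ℝ retract z v ∈ tangent (retract z) := by
  have hd := ((contDiffAt_retract hz).differentiableAt (by simp)).hasFDerivAt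
  have h1 := (hasFDerivAt_bil_self (retract z)).comp z hd
  have h2 : HasFDerivAt (fun w => bil (retract w) (retract w)) (0 : E →L[ℝ] ℂ) z := by
    refine (hasFDerivAt_const (1 : ℂ) z).congr_of_eventuallyEq ?_
    filter_upwards [isOpen_domain.mem_nhds hz] with w hw
    exact mem_X_iff.1 (retract_mem hw)
  have h3 := congrArg (fun l => l v) (h1.unique h2)
  have h4 : (2 : ℝ) • bil (retract z) (fderiv ℝ retract z v) = 0 := h3
  rw [mem_tangent_iff]
  simpa using h4

theorem fderiv_retract_of_mem {z v : E} (hz : z ∈ X) (hv : v ∈ tangent z) :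
    fderiv ℝ retract z v = v := by
  have hq := mem_X_iff.1 hz
  have h1 : HasDerivAt (fun q : ℂ => Complex.exp (-(1 / 2) * Complex.log q)) _ (bil z z) :=
    ((Complex.hasDerivAt_log (X_subset_domain hz)).const_mul (-(1 / 2) : ℂ)).cexp
  have h2 := HasFDerivAt.comp (f := fun w : E => bil w w) z
    (h1.hasFDerivAt.restrictScalars ℝ) (hasFDerivAt_bil_self z)
  have h3 : HasFDerivAt retract _ z := h2.smul (hasFDerivAt_id z)
  have h4 : bilL z v = 0 := hv
  rw [h3.fderiv]
  simp [h4, hq]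

/-- A form vanishing on the tangent spaces of `X` pulls back to zero under the retraction, and so
does its exterior derivative. -/
theorem extDeriv_eq_zero_of_tangent {b : OneForm} {z : E} (hz : z ∈ X)
    (hb : DifferentiableAt ℝ b z)
    (h0 : ∀ᶠ w in 𝓝 z, w ∈ X → ∀ u ∈ tangent w, b w ![u] = 0) {v v' : E}
    (hv : v ∈ tangent z) (hv' : v' ∈ tangent z) : extDeriv b z ![v, v'] = 0 := by
  have hzd := X_subset_domain hz
  have hr := contDiffAt_retract hzd
  have hb' : DifferentiableAt ℝ b (retract z) := by rwa [retract_of_mem hz]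
  have hp := extDeriv_pullback hb' hr (by
    rw [minSmoothness_of_isRCLikeNormedField]
    exact WithTop.coe_le_coe.2 (le_top : (2 : ℕ∞) ≤ ⊤))
  have hzero : (fun x => (b (retract x)).compContinuousLinearMap (fderiv ℝ retract x)) =ᶠ[𝓝 z]
      fun _ => 0 := by
    have hc : Tendsto retract (𝓝 z) (𝓝 z) := by
      have := hr.continuousAt.tendsto
      rwa [retract_of_mem hz] at this
    filter_upwards [hc.eventually h0, isOpen_domain.mem_nhds hzd] with x hx hxd
    ext u
    have hu : (fun i => fderiv ℝ retract x (u i)) = ![fderiv ℝ retract x (u 0)] := by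
      funext i
      fin_cases i
      rfl
    change b (retract x) (fun i => fderiv ℝ retract x (u i)) = 0
    rw [hu]
    exact hx (retract_mem hxd) _ (fderiv_retract_mem hxd _)
  rw [hzero.extDeriv_eq, retract_of_mem hz] at hp
  have h1 := congrArg (fun α => α ![v, v']) hp
  have h2 : (fun i => fderiv ℝ retract z (![v, v'] i)) = ![v, v'] := by
    funext i
    fin_cases i
    · exact fderiv_retract_of_mem hz hv
    · exact fderiv_retract_of_mem hz hv'
  have h3 : extDeriv b z (fun i => fderiv ℝ retract z (![v, v'] i)) = 0 := by
    have h4 : extDeriv (fun _ => 0 : OneForm) z = 0 := by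
      rw [extDeriv, fderiv_fun_const]
      exact map_zero (ContinuousAlternatingMap.alternatizeUncurryFinCLM ℝ E ℝ)
    rw [h4] at h1
    exact h1.symm
  rwa [h2] at h3

/-- The restriction to `T_z X` of the exterior derivative of a form only depends on the
restrictions of the form to the tangent spaces of `X` near `z`. -/
theorem extDeriv_congr_of_tangent {a b : OneForm} {z : E} (hz : z ∈ X)
    (ha : DifferentiableAt ℝ a z) (hb : DifferentiableAt ℝ b z)
    (h : ∀ᶠ w in 𝓝 z, w ∈ X → ∀ u ∈ tangent w, a w ![u] = b w ![u]) {v v' : E}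
    (hv : v ∈ tangent z) (hv' : v' ∈ tangent z) :
    extDeriv a z ![v, v'] = extDeriv b z ![v, v'] := by
  have hsplit : extDeriv a z = extDeriv (fun w => a w - b w) z + extDeriv b z := by
    have h := extDeriv_fun_add (ha.sub hb) hb
    simp only [Pi.sub_apply, sub_add_cancel] at h
    exact h
  have h0 := extDeriv_eq_zero_of_tangent (b := fun w => a w - b w) hz (ha.sub hb)
    (h.mono fun w hw hX u hu => sub_eq_zero.2 (hw hX u hu)) hv hv'
  rw [hsplit, ContinuousAlternatingMap.add_apply, h0, zero_add]

/-! ### Normal form of a point under the action -/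

/-- The curve `t ↦ (√((t+1)/2), i √((t-1)/2), 0, 0, 0)`, which meets every orbit of `SO(5)` on the
quadric once, parametrised by `t = r²`. -/
def crossSection (t : ℝ) : E := ![(√((t + 1) / 2) : ℂ), (√((t - 1) / 2) : ℂ) * Complex.I, 0, 0, 0]

theorem sum_sq_re_sub {z : E} (hz : z ∈ X) :
    ∑ j, (z j).re ^ 2 = ∑ j, (z j).im ^ 2 + 1 ∧ ∑ j, (z j).re * (z j).im = 0 := by
  have h : ∑ j, z j ^ 2 = 1 := hz
  have h1 := congrArg Complex.re h
  have h2 := congrArg Complex.im h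
  simp only [Complex.re_sum, Complex.im_sum, sq, Complex.mul_re, Complex.mul_im, Complex.one_re,
    Complex.one_im, Finset.sum_sub_distrib, Finset.sum_add_distrib] at h1 h2
  have h3 : ∑ j, (z j).im * (z j).re = ∑ j, (z j).re * (z j).im :=
    Finset.sum_congr rfl fun _ _ => mul_comm _ _
  simp only [sq]
  constructor <;> linarith

/-- On the quadric, `R₊² = (r² + 1) / 2` and `R₋² = (r² - 1) / 2`. -/
theorem sum_sq_eq_of_mem {z : E} (hz : z ∈ X) :
    ∑ j, (z j).re ^ 2 = (radiusSq z + 1) / 2 ∧ ∑ j, (z j).im ^ 2 = (radiusSq z - 1) / 2 := by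
  have h := (sum_sq_re_sub hz).1
  have h1 : radiusSq z = ∑ j, (z j).re ^ 2 + ∑ j, (z j).im ^ 2 := by
    simp only [radiusSq, Complex.normSq_apply, ← Finset.sum_add_distrib, sq]
  constructor <;> linarith

theorem one_le_radiusSq {z : E} (hz : z ∈ X) : 1 ≤ radiusSq z := by
  have h := (sum_sq_eq_of_mem hz).2
  have : 0 ≤ ∑ j, (z j).im ^ 2 := Finset.sum_nonneg fun _ _ => sq_nonneg _
  linarith

theorem mem_S4_iff {z : E} (hz : z ∈ X) : z ∈ S4 ↔ radiusSq z = 1 := by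
  have h := (sum_sq_eq_of_mem hz).2
  constructor
  · rintro ⟨_, h0⟩
    simp [h0] at h
    linarith
  · intro h1
    refine ⟨hz, fun j => ?_⟩
    rw [h1, sub_self, zero_div, Finset.sum_eq_zero_iff_of_nonneg fun _ _ => sq_nonneg _] at h
    exact pow_eq_zero_iff two_ne_zero |>.1 (h j (Finset.mem_univ j))

theorem mem_X_diff_S4_iff {z : E} : z ∈ X \ S4 ↔ z ∈ X ∧ 1 < radiusSq z := by
  constructor
  · rintro ⟨hz, h⟩
    exact ⟨hz, lt_of_le_of_ne (one_le_radiusSq hz) fun h1 => h ((mem_S4_iff hz).2 h1.symm)⟩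
  · rintro ⟨hz, h⟩
    exact ⟨hz, fun h1 => h.ne' ((mem_S4_iff hz).1 h1)⟩

/-- A pair of orthogonal vectors of `ℝ⁵` is carried by `SO(5)` into the first two coordinate
axes. -/
theorem exists_specialOrthogonal (x y : Fin 5 → ℝ) (hx : ∑ j, x j ^ 2 ≠ 0)
    (hxy : ∑ j, x j * y j = 0) :
    ∃ h ∈ Matrix.specialOrthogonalGroup (Fin 5) ℝ,
      (∀ j, x j = √(∑ j, x j ^ 2) * h j 0) ∧ ∀ j, y j = √(∑ j, y j ^ 2) * h j 1 := by
  let x' : EuclideanSpace ℝ (Fin 5) := WithLp.toLp 2 x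
  let y' : EuclideanSpace ℝ (Fin 5) := WithLp.toLp 2 y
  have hnx : ‖x'‖ = √(∑ j, x j ^ 2) := by
    simp [x', EuclideanSpace.norm_eq]
  have hny : ‖y'‖ = √(∑ j, y j ^ 2) := by
    simp [y', EuclideanSpace.norm_eq]
  have hx0 : ‖x'‖ ≠ 0 := by
    rw [hnx, Real.sqrt_ne_zero']
    exact lt_of_le_of_ne (Finset.sum_nonneg fun _ _ => sq_nonneg _) (Ne.symm hx)
  have hin : inner ℝ x' y' = 0 := by
    simp [x', y', PiLp.inner_apply]
    rw [← hxy]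
    exact Finset.sum_congr rfl fun _ _ => mul_comm _ _
  obtain ⟨b, hb0, hb1⟩ : ∃ b : OrthonormalBasis (Fin 5) ℝ (EuclideanSpace ℝ (Fin 5)),
      x' = ‖x'‖ • b 0 ∧ y' = ‖y'‖ • b 1 := by
    have hux : ‖(‖x'‖⁻¹ • x')‖ = 1 := by
      rw [norm_smul, norm_inv, norm_norm, inv_mul_cancel₀ hx0]
    by_cases hy0 : ‖y'‖ = 0
    · obtain ⟨b, hb⟩ := Orthonormal.exists_orthonormalBasis_extension_of_card_eq (ι := Fin 5)
        (𝕜 := ℝ) (E := EuclideanSpace ℝ (Fin 5)) (by simp) (v := fun _ => ‖x'‖⁻¹ • x')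
        (s := {0}) ⟨fun i => hux, fun i j hij => absurd (Subsingleton.elim i j) hij⟩
      refine ⟨b, ?_, ?_⟩
      · rw [hb 0 rfl, smul_smul, mul_inv_cancel₀ hx0, one_smul]
      · rw [hy0, zero_smul, norm_eq_zero.1 hy0]
    · have huy : ‖(‖y'‖⁻¹ • y')‖ = 1 := by
        rw [norm_smul, norm_inv, norm_norm, inv_mul_cancel₀ hy0]
      have hin' : inner ℝ y' x' = 0 := by rw [real_inner_comm, hin]
      obtain ⟨b, hb⟩ := Orthonormal.exists_orthonormalBasis_extension_of_card_eq (ι := Fin 5)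
        (𝕜 := ℝ) (E := EuclideanSpace ℝ (Fin 5)) (by simp)
        (v := ![‖x'‖⁻¹ • x', ‖y'‖⁻¹ • y', 0, 0, 0]) (s := {0, 1}) (by
          refine ⟨?_, ?_⟩
          · rintro ⟨i, rfl | rfl⟩
            · exact hux
            · exact huy
          · rintro ⟨i, rfl | rfl⟩ ⟨j, rfl | rfl⟩ hij
            · exact absurd rfl hij
            · simp [inner_smul_left, inner_smul_right, hin]
            · simp [inner_smul_left, inner_smul_right, hin']
            · exact absurd rfl hij)
      refine ⟨b, ?_, ?_⟩
      · rw [hb 0 (by simp)]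
        simp [smul_smul, mul_inv_cancel₀ hx0]
      · rw [hb 1 (by simp)]
        simp [smul_smul, mul_inv_cancel₀ hy0]
  let h : Matrix (Fin 5) (Fin 5) ℝ := Matrix.of fun i j => b j i
  have hh : h.transpose * h = 1 := by
    ext i j
    have := b.inner_eq_ite i j
    rw [PiLp.inner_apply] at this
    simp only [Matrix.mul_apply, Matrix.one_apply, Matrix.transpose_apply, h, Matrix.of_apply]
    rw [← this]
    exact Finset.sum_congr rfl fun _ _ => mul_comm _ _
  have h0 : ∀ j, x j = √(∑ j, x j ^ 2) * h j 0 := fun j => by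
    rw [← hnx]
    exact congrArg (fun v : EuclideanSpace ℝ (Fin 5) => v j) hb0
  have h1 : ∀ j, y j = √(∑ j, y j ^ 2) * h j 1 := fun j => by
    rw [← hny]
    exact congrArg (fun v : EuclideanSpace ℝ (Fin 5) => v j) hb1
  have hdet : h.det = 1 ∨ h.det = -1 := by
    have := congrArg Matrix.det hh
    rw [Matrix.det_mul, Matrix.det_transpose, Matrix.det_one] at this
    exact mul_self_eq_one_iff.1 this
  rcases hdet with hdet | hdet
  · exact ⟨h, Matrix.mem_specialOrthogonalGroup_iff.2
      ⟨(Matrix.mem_orthogonalGroup_iff' _ _).2 hh, hdet⟩, h0, h1⟩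
  · -- Reversing the last column makes the determinant positive.
    let d : Fin 5 → ℝ := ![1, 1, 1, 1, -1]
    refine ⟨h * Matrix.diagonal d, Matrix.mem_specialOrthogonalGroup_iff.2
      ⟨(Matrix.mem_orthogonalGroup_iff' _ _).2 ?_, ?_⟩, fun j => ?_, fun j => ?_⟩
    · change (h * Matrix.diagonal d).transpose * (h * Matrix.diagonal d) = 1
      rw [Matrix.transpose_mul, Matrix.mul_assoc, ← Matrix.mul_assoc h.transpose, hh,
        Matrix.one_mul, Matrix.diagonal_transpose, Matrix.diagonal_mul_diagonal,
        ← Matrix.diagonal_one]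
      congr 1
      funext i
      fin_cases i <;> simp [d]
    · rw [Matrix.det_mul, Matrix.det_diagonal, hdet]
      simp [d, Fin.prod_univ_succ]
    · rw [Matrix.mul_diagonal]
      simpa [d] using h0 j
    · rw [Matrix.mul_diagonal]
      simpa [d] using h1 j

theorem exists_act_crossSection {z : E} (hz : z ∈ X) :
    ∃ h ∈ Matrix.specialOrthogonalGroup (Fin 5) ℝ, z = act h (crossSection (radiusSq z)) := by
  obtain ⟨h, hh, hx, hy⟩ := exists_specialOrthogonal (fun j => (z j).re) (fun j => (z j).im)
    (by rw [(sum_sq_eq_of_mem hz).1]; linarith [one_le_radiusSq hz]) (sum_sq_re_sub hz).2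
  rw [(sum_sq_eq_of_mem hz).1] at hx
  rw [(sum_sq_eq_of_mem hz).2] at hy
  refine ⟨h, hh, ?_⟩
  funext j
  rw [act_apply, ← Complex.re_add_im (z j), hx j, hy j]
  simp [Fin.sum_univ_succ, crossSection]
  ring

/-! ### The cross-section of the action -/

/-- The derivative of `crossSection`. -/
def velocity (t : ℝ) : E :=
  ![((4 * √((t + 1) / 2))⁻¹ : ℝ), ((4 * √((t - 1) / 2))⁻¹ : ℝ) * Complex.I, 0, 0, 0]

theorem continuous_crossSection : Continuous crossSection := by
  refine continuous_pi fun j => ?_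
  fin_cases j <;> simp [crossSection] <;> fun_prop

theorem hasDerivAt_sqrt_half {t e : ℝ} (h : 0 < (t + e) / 2) :
    HasDerivAt (fun t => ((√((t + e) / 2) : ℝ) : ℂ)) (((4 * √((t + e) / 2))⁻¹ : ℝ) : ℂ) t := by
  refine HasDerivAt.ofReal_comp ?_
  refine ((((hasDerivAt_id t).add_const e).div_const 2).sqrt h.ne').congr_deriv ?_
  simp only [id]
  field_simp
  norm_num

theorem hasDerivAt_crossSection {t : ℝ} (ht : 1 < t) :
    HasDerivAt crossSection (velocity t) t := by
  rw [hasDerivAt_pi]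
  intro j
  fin_cases j
  · exact hasDerivAt_sqrt_half (by linarith)
  · have h := hasDerivAt_sqrt_half (t := t) (e := -1) (by linarith)
    simp only [← sub_eq_add_neg] at h
    exact h.mul_const Complex.I
  all_goals exact hasDerivAt_const _ _

theorem contDiffOn_crossSection : ContDiffOn ℝ ∞ crossSection (Ioi 1) := by
  rw [contDiffOn_pi]
  intro j
  have h : ∀ e : ℝ, -1 ≤ e → ContDiffOn ℝ ∞ (fun t => ((√((t + e) / 2) : ℝ) : ℂ)) (Ioi 1) := by
    intro e he
    refine Complex.ofRealCLM.contDiff.comp_contDiffOn (ContDiffOn.sqrt ?_ ?_)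
    · exact ((contDiff_id.add contDiff_const).div_const 2).contDiffOn
    · intro t ht
      have : (1 : ℝ) < t := ht
      have : 0 < (t + e) / 2 := by linarith
      exact this.ne'
  fin_cases j
  · exact h 1 (by norm_num)
  · have h1 := h (-1) le_rfl
    simp only [← sub_eq_add_neg] at h1
    exact h1.mul contDiffOn_const
  all_goals exact contDiffOn_const

theorem contDiffOn_velocity : ContDiffOn ℝ ∞ velocity (Ioi 1) :=
  ((contDiffOn_crossSection.deriv_of_isOpen isOpen_Ioi (m := ∞) le_rfl)).congr fun _ ht =>
    (hasDerivAt_crossSection ht).deriv.symm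

theorem bil_crossSection {t : ℝ} (ht : 1 ≤ t) : bil (crossSection t) (crossSection t) = 1 := by
  have h1 : ((√((t + 1) / 2) : ℝ) : ℂ) ^ 2 = (((t + 1) / 2 : ℝ) : ℂ) := by
    rw [← Complex.ofReal_pow, Real.sq_sqrt (by linarith)]
  have h2 : ((√((t - 1) / 2) : ℝ) : ℂ) ^ 2 = (((t - 1) / 2 : ℝ) : ℂ) := by
    rw [← Complex.ofReal_pow, Real.sq_sqrt (by linarith)]
  simp only [bil, crossSection, Fin.sum_univ_five, Matrix.cons_val]
  push_cast at h1 h2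
  linear_combination h1 - h2 + ((√((t - 1) / 2) : ℝ) : ℂ) ^ 2 * Complex.I_sq

theorem crossSection_mem_X {t : ℝ} (ht : 1 ≤ t) : crossSection t ∈ X :=
  mem_X_iff.2 (bil_crossSection ht)

theorem radiusSq_crossSection {t : ℝ} (ht : 1 ≤ t) : radiusSq (crossSection t) = t := by
  have h1 : √((t + 1) / 2) ^ 2 = (t + 1) / 2 := Real.sq_sqrt (by linarith)
  have h2 : √((t - 1) / 2) ^ 2 = (t - 1) / 2 := Real.sq_sqrt (by linarith)
  simp only [radiusSq, crossSection, Fin.sum_univ_five, Matrix.cons_val, map_mul,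
    Complex.normSq_ofReal, Complex.normSq_I, map_zero]
  linear_combination h1 + h2

theorem crossSection_mem {t : ℝ} (ht : 1 < t) : crossSection t ∈ X \ S4 :=
  mem_X_diff_S4_iff.2 ⟨crossSection_mem_X ht.le, by rwa [radiusSq_crossSection ht.le]⟩

theorem herm_crossSection (t : ℝ) (v : E) : herm (crossSection t) v =
    √((t + 1) / 2) * v 0 - √((t - 1) / 2) * Complex.I * v 1 := by
  simp [herm, crossSection, Fin.sum_univ_five]
  ring

theorem bil_crossSection_left (t : ℝ) (v : E) : bil (crossSection t) v =
    √((t + 1) / 2) * v 0 + √((t - 1) / 2) * Complex.I * v 1 := by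
  simp [bil, crossSection, Fin.sum_univ_five]

theorem velocity_mem_tangent {t : ℝ} (ht : 1 < t) : velocity t ∈ tangent (crossSection t) := by
  have h1 : ((√((t + 1) / 2) : ℝ) : ℂ) ≠ 0 :=
    Complex.ofReal_ne_zero.2 (Real.sqrt_ne_zero'.2 (by linarith))
  have h2 : ((√((t - 1) / 2) : ℝ) : ℂ) ≠ 0 :=
    Complex.ofReal_ne_zero.2 (Real.sqrt_ne_zero'.2 (by linarith))
  rw [mem_tangent_iff, bil_crossSection_left]
  simp only [velocity, Matrix.cons_val]
  push_cast
  field_simp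
  simp

theorem herm_velocity {t : ℝ} (ht : 1 < t) : herm (crossSection t) (velocity t) = 1 / 2 := by
  have h1 : ((√((t + 1) / 2) : ℝ) : ℂ) ≠ 0 :=
    Complex.ofReal_ne_zero.2 (Real.sqrt_ne_zero'.2 (by linarith))
  have h2 : ((√((t - 1) / 2) : ℝ) : ℂ) ≠ 0 :=
    Complex.ofReal_ne_zero.2 (Real.sqrt_ne_zero'.2 (by linarith))
  rw [herm_crossSection]
  simp only [velocity, Matrix.cons_val]
  push_cast
  field_simp
  simp
  norm_num

/-- A tangent vector along the cross-section splits into a complex multiple of the velocity and a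
vector in the last three coordinates. -/
theorem tangent_crossSection_eq {t : ℝ} (ht : 1 < t) {v : E} (hv : v ∈ tangent (crossSection t)) :
    v = (2 * herm (crossSection t) v) • velocity t + ![0, 0, v 2, v 3, v 4] := by
  have h1 : ((√((t + 1) / 2) : ℝ) : ℂ) ≠ 0 :=
    Complex.ofReal_ne_zero.2 (Real.sqrt_ne_zero'.2 (by linarith))
  have h2 : ((√((t - 1) / 2) : ℝ) : ℂ) ≠ 0 :=
    Complex.ofReal_ne_zero.2 (Real.sqrt_ne_zero'.2 (by linarith))
  rw [mem_tangent_iff, bil_crossSection_left] at hv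
  rw [herm_crossSection, velocity]
  generalize √((t + 1) / 2) = c at *
  generalize √((t - 1) / 2) = s at *
  funext j
  fin_cases j
  · simp
    field_simp
    linear_combination 2 * hv
  · simp
    field_simp
    linear_combination -2 * Complex.I * hv + 4 * (s : ℂ) * v 1 * Complex.I_sq
  all_goals simp

/-! ### Invariant `1`-forms -/

theorem act_mul (h k : Matrix (Fin 5) (Fin 5) ℝ) (v : E) : act (h * k) v = act h (act k v) := by
  funext i
  simp only [act_apply, Matrix.mul_apply, Complex.ofReal_sum, Complex.ofReal_mul, Finset.sum_mul,
    Finset.mul_sum]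
  rw [Finset.sum_comm]
  exact Finset.sum_congr rfl fun _ _ => Finset.sum_congr rfl fun _ _ => by ring

theorem act_one (v : E) : act 1 v = v := by
  funext i
  rw [act_apply, Finset.sum_eq_single i (fun k _ hk => by simp [Ne.symm hk])
    (by simp)]
  simp

theorem exists_act_eq {h : Matrix (Fin 5) (Fin 5) ℝ}
    (hh : h ∈ Matrix.specialOrthogonalGroup (Fin 5) ℝ) (v : E) : ∃ w, v = act h w := by
  refine ⟨act h.transpose v, ?_⟩
  have h1 : h * h.transpose = 1 := (Matrix.mem_orthogonalGroup_iff (Fin 5) ℝ).1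
    (Matrix.mem_specialOrthogonalGroup_iff.1 hh).1
  rw [← act_mul, h1, act_one]

theorem diagonal_mem {d : Fin 5 → ℝ} (hd : ∀ i, d i * d i = 1) (hp : ∏ i, d i = 1) :
    Matrix.diagonal d ∈ Matrix.specialOrthogonalGroup (Fin 5) ℝ := by
  refine Matrix.mem_specialOrthogonalGroup_iff.2 ⟨(Matrix.mem_orthogonalGroup_iff' _ _).2 ?_, ?_⟩
  · change (Matrix.diagonal d).transpose * Matrix.diagonal d = 1
    rw [Matrix.diagonal_transpose, Matrix.diagonal_mul_diagonal, ← Matrix.diagonal_one]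
    congr 1
    funext i
    exact hd i
  · rw [Matrix.det_diagonal, hp]

theorem act_diagonal (d : Fin 5 → ℝ) (v : E) :
    act (Matrix.diagonal d) v = fun j => (d j : ℂ) * v j := by
  funext i
  rw [act_apply, Finset.sum_eq_single i (fun k _ hk => by simp [Ne.symm hk])
    (by simp)]
  simp

/-- The coefficient of `d(r²)` of an invariant `1`-form. -/
def radialCoeff (a : OneForm) (t : ℝ) : ℝ := a (crossSection t) ![velocity t]

/-- The coefficient of `Im ∑ z̄ⱼ dzⱼ` of an invariant `1`-form; the factor `2` compensates
`Im ∑ z̄ⱼ dzⱼ (i ∂ₜ) = ½`. -/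
def angularCoeff (a : OneForm) (t : ℝ) : ℝ :=
  2 * a (crossSection t) ![Complex.I • velocity t]

/-- An invariant `1`-form on `X ∖ S⁴` is a combination of `d(r²)` and `Im ∑ z̄ⱼ dzⱼ`: the stabiliser
`SO(3)` of a point has no invariant functionals on the remaining six dimensions. -/
theorem IsInvariant.eq_radial {a : OneForm} (ha : IsInvariant (X \ S4) a) {z v : E}
    (hz : z ∈ X \ S4) (hv : v ∈ tangent z) :
    a z ![v] = angularCoeff a (radiusSq z) * imL z v +
      radialCoeff a (radiusSq z) * (2 * reL z v) := by
  obtain ⟨hX, ht⟩ := mem_X_diff_S4_iff.1 hz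
  obtain ⟨h, hh, hzh⟩ := exists_act_crossSection hX
  obtain ⟨w, rfl⟩ := exists_act_eq hh v
  have hcs := crossSection_mem ht
  set c := crossSection (radiusSq z) with hc
  have hw : w ∈ tangent c := by
    rw [mem_tangent_iff, hzh, bil_act hh] at hv
    exact hv
  have h1 : a z ![act h w] = a c ![w] := by
    conv_lhs => rw [hzh]
    exact ha h hh c hcs w hw
  have h2 : herm z (act h w) = herm c w := by
    conv_lhs => rw [hzh]
    exact herm_act hh _ _
  -- The diagonal matrices with two entries `-1` among the last three fix the point and average
  -- vectors in the last three coordinates to zero.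
  have h3 : toForm.symm (a c) ![0, 0, w 2, w 3, w 4] = 0 := by
    set u : E := ![0, 0, w 2, w 3, w 4] with hu
    have hut : u ∈ tangent c := by
      rw [mem_tangent_iff, hc, bil_crossSection_left]
      simp [hu]
    have hflip : ∀ d : Fin 5 → ℝ, (∀ i, d i * d i = 1) → ∏ i, d i = 1 → d 0 = 1 → d 1 = 1 →
        toForm.symm (a c) (act (Matrix.diagonal d) u) = toForm.symm (a c) u := by
      intro d hd hp hd0 hd1
      have h4 := ha _ (diagonal_mem hd hp) c hcs u hut
      have h5 : act (Matrix.diagonal d) c = c := by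
        rw [act_diagonal]
        funext j
        fin_cases j <;> simp [hc, crossSection, hd0, hd1]
      rw [h5] at h4
      rw [toForm_symm_apply, toForm_symm_apply, h4]
    have e1 := hflip ![1, 1, 1, -1, -1] (by intro i; fin_cases i <;> simp)
      (by simp [Fin.prod_univ_succ]) rfl rfl
    have e2 := hflip ![1, 1, -1, 1, -1] (by intro i; fin_cases i <;> simp)
      (by simp [Fin.prod_univ_succ]) rfl rfl
    have e3 := hflip ![1, 1, -1, -1, 1] (by intro i; fin_cases i <;> simp)
      (by simp [Fin.prod_univ_succ]) rfl rfl
    have hsum : act (Matrix.diagonal ![1, 1, 1, -1, -1]) u +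
        act (Matrix.diagonal ![1, 1, -1, 1, -1]) u +
        act (Matrix.diagonal ![1, 1, -1, -1, 1]) u = -u := by
      simp only [act_diagonal]
      funext j
      fin_cases j <;> simp [hu]
    have e4 := congrArg (toForm.symm (a c)) hsum
    rw [map_add, map_add, map_neg, e1, e2, e3] at e4
    linarith
  have h4 : toForm.symm (a c) w = (2 * (herm c w).re) * toForm.symm (a c) (velocity (radiusSq z)) +
      (2 * (herm c w).im) * toForm.symm (a c) (Complex.I • velocity (radiusSq z)) := by
    conv_lhs => rw [tangent_crossSection_eq ht hw]
    rw [← hc, map_add, h3, add_zero]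
    have : (2 * herm c w) • velocity (radiusSq z) =
        (2 * (herm c w).re) • velocity (radiusSq z) +
        (2 * (herm c w).im) • (Complex.I • velocity (radiusSq z)) := by
      funext j
      simp only [Pi.smul_apply, Pi.add_apply, smul_eq_mul, Complex.real_smul]
      conv_lhs => rw [← Complex.re_add_im (herm c w)]
      push_cast
      ring
    rw [this, map_add, map_smul, map_smul, smul_eq_mul, smul_eq_mul]
  rw [h1, imL_apply, reL_apply, h2, radialCoeff, angularCoeff, ← hc, ← toForm_symm_apply,
    ← toForm_symm_apply, ← toForm_symm_apply, h4]
  ring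

/-- An invariant `1`-form vanishes along `S⁴`: the stabiliser contains an element acting by `-1` on
the tangent space. -/
theorem IsInvariant.eq_zero_of_mem_S4 {a : OneForm} (ha : IsInvariant X a) {z v : E}
    (hz : z ∈ S4) (hv : v ∈ tangent z) : a z ![v] = 0 := by
  obtain ⟨h, hh, hzh⟩ := exists_act_crossSection hz.1
  rw [(mem_S4_iff hz.1).1 hz] at hzh
  obtain ⟨w, rfl⟩ := exists_act_eq hh v
  have hX := crossSection_mem_X le_rfl
  set c := crossSection 1 with hc
  have hw : w ∈ tangent c := by
    rw [mem_tangent_iff, hzh, bil_act hh] at hv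
    exact hv
  rw [hzh, ha h hh c hX w hw]
  have h1 := ha _ (diagonal_mem (d := ![1, -1, -1, -1, -1]) (by intro i; fin_cases i <;> simp)
    (by simp [Fin.prod_univ_succ])) c hX w hw
  have h2 : act (Matrix.diagonal ![1, -1, -1, -1, -1]) c = c := by
    rw [act_diagonal]
    funext j
    fin_cases j <;> simp [hc, crossSection]
  have h3 : act (Matrix.diagonal ![1, -1, -1, -1, -1]) w = -w := by
    have h0 : w 0 = 0 := by
      rw [mem_tangent_iff, hc, bil_crossSection_left] at hw
      simpa using hw
    rw [act_diagonal]
    funext j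
    fin_cases j <;> simp [h0]
  rw [h2, h3, ← toForm_symm_apply, ← toForm_symm_apply, map_neg] at h1
  rw [← toForm_symm_apply]
  linarith

/-! ### Unitary frames of the Stenzel metric -/

theorem restrict_apply_pair (z : E) (α : E [⋀^Fin 2]→ₗ[ℝ] ℝ) (v w : tangent z) :
    restrict z α ![v, w] = α ![(v : E), (w : E)] := by
  refine congrArg α ?_
  funext i
  fin_cases i <;> rfl

theorem I_smul_mem_tangent {z v : E} (hv : v ∈ tangent z) : Complex.I • v ∈ tangent z := by
  rw [mem_tangent_iff] at hv ⊢
  rw [bil_smul_right, hv, mul_zero]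

/-- The frame `(u i, J (u i))`, rescaled by `1 / √(m i)`; it is unitary if the `u i` are orthogonal
with `g(u i, u i) = m i`. -/
def unitaryFrame {z : E} (u : Fin 4 → tangent z) (m : Fin 4 → ℝ) (i : Fin 4) (a : Fin 2) :
    tangent z :=
  (√(m i))⁻¹ • ![u i, ⟨Complex.I • (u i : E), I_smul_mem_tangent (u i).2⟩] a

/-- A hermitian orthogonal frame, with at most one member not orthogonal to `z`, diagonalises all
radial two-forms at once. -/
theorem radialTwoForm_unitaryFrame {z : E} {u : Fin 4 → tangent z} {ν l m : Fin 4 → ℝ}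
    (hν : ∀ i j, herm (u i : E) (u j : E) = if i = j then (ν i : ℂ) else 0)
    (hl : ∀ i, herm z (u i : E) = (l i : ℂ)) (hll : ∀ i j, i ≠ j → l i * l j = 0)
    (hm : ∀ i, 0 < m i) (p q : ℝ) (i j : Fin 4) (a b : Fin 2) :
    radialTwoForm p q z (unitaryFrame u m i a : E) (unitaryFrame u m j b : E) =
      if i = j then (p * l i ^ 2 + q * ν i) / m i * (!![0, 1; -1, 0] : Matrix _ _ ℝ) a b
      else 0 := by
  have hs : √(m i) * √(m i) = m i := Real.mul_self_sqrt (hm i).le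
  have hs0 : √(m i) ≠ 0 := Real.sqrt_ne_zero'.2 (hm i)
  have key : radialTwoForm p q z ((![u i, ⟨Complex.I • (u i : E), I_smul_mem_tangent (u i).2⟩] a :
        tangent z) : E) ((![u j, ⟨Complex.I • (u j : E), I_smul_mem_tangent (u j).2⟩] b :
        tangent z) : E) =
      if i = j then (p * l i ^ 2 + q * ν i) * (!![0, 1; -1, 0] : Matrix _ _ ℝ) a b else 0 := by
    by_cases hij : i = j
    · subst hij
      fin_cases a <;> fin_cases b <;>
        simp [radialTwoForm, reL_apply, imL_apply, herm_smul_left, herm_smul_right, hl, hν,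
          ← sq] <;> ring
    · have h : l i = 0 ∨ l j = 0 := mul_eq_zero.1 (hll i j hij)
      fin_cases a <;> fin_cases b <;>
        simp [radialTwoForm, reL_apply, imL_apply, herm_smul_left, herm_smul_right, hl, hν, hij] <;>
        tauto
  have hscale : radialTwoForm p q z (unitaryFrame u m i a : E) (unitaryFrame u m j b : E) =
      (√(m i))⁻¹ * (√(m j))⁻¹ * radialTwoForm p q z
        ((![u i, ⟨Complex.I • (u i : E), I_smul_mem_tangent (u i).2⟩] a : tangent z) : E)
        ((![u j, ⟨Complex.I • (u j : E), I_smul_mem_tangent (u j).2⟩] b : tangent z) : E) := by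
    simp only [radialTwoForm, unitaryFrame, Submodule.coe_smul, map_smul, smul_eq_mul,
      smul_apply]
    ring
  rw [hscale, key]
  split_ifs with hij
  · subst hij
    rw [← mul_inv, hs]
    ring
  · simp

/-- The Stenzel metric as a bilinear form. -/
def metricL (z : E) : tangent z →ₗ[ℝ] tangent z →ₗ[ℝ] ℝ :=
  (kahlerAmbient z).toBilin.compl₁₂ (tangent z).subtype (J.toLinearMap ∘ₗ (tangent z).subtype)

theorem finrank_tangent {z : E} (hz : z ∈ X) : Module.finrank ℝ (tangent z) = 8 := by
  have hker : tangent z = LinearMap.ker (bilL z).toLinearMap := by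
    ext v
    exact Iff.rfl
  have hsurj : Function.Surjective (bilL z).toLinearMap := by
    intro c
    refine ⟨c • z, ?_⟩
    change bil z (c • z) = c
    rw [bil_smul_right, mem_X_iff.1 hz, mul_one]
  have h := LinearMap.finrank_range_add_finrank_ker (bilL z).toLinearMap
  rw [LinearMap.range_eq_top.2 hsurj, finrank_top, Complex.finrank_real_complex,
    Module.finrank_pi_fintype] at h
  simp only [Complex.finrank_real_complex, Finset.sum_const, Finset.card_univ, Fintype.card_fin,
    smul_eq_mul] at h
  rw [hker]
  omega

section Frame

variable {z : E} {u : Fin 4 → tangent z} {ν l m : Fin 4 → ℝ}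

theorem isDiagonal_unitaryFrame
    (hν : ∀ i j, herm (u i : E) (u j : E) = if i = j then (ν i : ℂ) else 0)
    (hl : ∀ i, herm z (u i : E) = (l i : ℂ)) (hll : ∀ i j, i ≠ j → l i * l j = 0)
    (hm : ∀ i, 0 < m i) {α : tangent z [⋀^Fin 2]→ₗ[ℝ] ℝ} {p q : ℝ}
    (hα : ∀ v w : tangent z, α ![v, w] = radialTwoForm p q z v w) :
    IsDiagonal α (unitaryFrame u m) fun i => (p * l i ^ 2 + q * ν i) / m i := by
  intro i j a b
  rw [hα, radialTwoForm_unitaryFrame hν hl hll hm]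

theorem isDiagonal_omega
    (hν : ∀ i j, herm (u i : E) (u j : E) = if i = j then (ν i : ℂ) else 0)
    (hl : ∀ i, herm z (u i : E) = (l i : ℂ)) (hll : ∀ i j, i ≠ j → l i * l j = 0)
    (hm : ∀ i, 0 < m i)
    (hmω : ∀ i, m i = deriv kp (radiusSq z) * l i ^ 2 + kp (radiusSq z) * ν i) :
    IsDiagonal (omega z) (unitaryFrame u m) fun _ => 1 := by
  have h := isDiagonal_unitaryFrame hν hl hll hm (α := omega z)
    (fun v w => (restrict_apply_pair z _ v w).trans (kahlerAmbient_apply z v w))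
  have h1 : (fun i => (deriv kp (radiusSq z) * l i ^ 2 + kp (radiusSq z) * ν i) / m i) =
      fun _ => 1 := by
    funext i
    rw [← hmω, div_self (hm i).ne']
  rwa [h1] at h

theorem J_unitaryFrame (i : Fin 4) (a : Fin 2) :
    J (unitaryFrame u m i a : E) =
      (if a = 0 then (1 : ℝ) else -1) • (unitaryFrame u m i (1 - a) : E) := by
  fin_cases a
  · simp [unitaryFrame, J]
  · simp [unitaryFrame, J]
    rw [smul_smul Complex.I, Complex.I_mul_I, neg_smul, one_smul,
      smul_neg]

theorem metricL_unitaryFrame (hω : IsDiagonal (omega z) (unitaryFrame u m) fun _ => 1)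
    (a b : Fin 4 × Fin 2) :
    metricL z (unitaryFrame u m a.1 a.2) (unitaryFrame u m b.1 b.2) = if a = b then 1 else 0 := by
  obtain ⟨i, a⟩ := a
  obtain ⟨j, b⟩ := b
  have h := hω i j a (1 - b)
  rw [omega, restrict_apply_pair] at h
  change (kahlerAmbient z).toBilin (unitaryFrame u m i a : E) (J (unitaryFrame u m j b : E)) = _
  rw [J_unitaryFrame, map_smul, AlternatingMap.toBilin_apply, h]
  by_cases hij : i = j
  · subst hij
    fin_cases a <;> fin_cases b <;> simp
  · simp [hij]

theorem exists_basis_unitaryFrame (hz : z ∈ X)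
    (hω : IsDiagonal (omega z) (unitaryFrame u m) fun _ => 1) :
    ∃ e : Module.Basis (Fin 4 × Fin 2) ℝ (tangent z),
      ∀ p, e p = unitaryFrame u m p.1 p.2 := by
  have hli : LinearIndependent ℝ fun p : Fin 4 × Fin 2 => unitaryFrame u m p.1 p.2 := by
    refine LinearMap.linearIndependent_of_isOrthoᵢ (B := metricL z) ?_ ?_
    · intro p q hpq
      change metricL z _ _ = 0
      rw [metricL_unitaryFrame hω, if_neg hpq]
    · intro p hp
      have h1 : metricL z _ _ = 0 := hp
      rw [metricL_unitaryFrame hω, if_pos rfl] at h1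
      exact one_ne_zero h1
  have hcard : Fintype.card (Fin 4 × Fin 2) = Module.finrank ℝ (tangent z) := by
    rw [finrank_tangent hz]
    rfl
  exact ⟨basisOfLinearIndependentOfCardEqFinrank hli hcard, fun p => by simp⟩

/-- A complex `4`-form vanishes on a tuple containing `v` and `i v`. -/
theorem holVol_eq_zero (z : E) (v : Fin 4 → E) (h : v 1 = Complex.I • v 0) : holVol z v = 0 := by
  have h1 : v = Function.update v 1 (Complex.I • v 0) := by
    rw [← h, Function.update_eq_self]
  rw [h1, AlternatingMap.map_update_smul, (holVol z).map_update_self v (by decide), smul_zero]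

theorem restrict_apply (z : E) {k : ℕ} (α : E [⋀^Fin k]→ₗ[ℝ] ℝ) (v : Fin k → tangent z) :
    restrict z α v = α fun i => (v i : E) := rfl

theorem reForm_apply {k : ℕ} (α : E [⋀^Fin k]→ₗ[ℂ] ℂ) (v : Fin k → E) :
    reForm α v = (α v).re := rfl

theorem reOmega_unitaryFrame (π : Fin 4 → Fin 4) :
    reOmega z (frameTuple (unitaryFrame u m ∘ π) 4) = 0 := by
  have h : holVol z (fun i => ((frameTuple (unitaryFrame u m ∘ π) 4 i : tangent z) : E)) = 0 := by
    refine holVol_eq_zero _ _ ?_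
    change ((√(m (π 0)))⁻¹ • (Complex.I • (u (π 0) : E))) =
      Complex.I • ((√(m (π 0)))⁻¹ • (u (π 0) : E))
    funext j
    simp only [Pi.smul_apply, Complex.real_smul, smul_eq_mul]
    ring
  rw [reOmega, restrict_apply, reForm_apply, h, Complex.zero_re]

theorem vol_frame (hω : IsDiagonal (omega z) (unitaryFrame u m) fun _ => 1) {π : Fin 4 → Fin 4}
    (hπ : Function.Injective π) :
    vol z (frameTuple (unitaryFrame u m ∘ π) (2 + 2 + 2 + 2)) = 1 := by
  have h := volume_frame hω hπ
  unfold vol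
  exact h

theorem cayley_frame (hω : IsDiagonal (omega z) (unitaryFrame u m) fun _ => 1) {π : Fin 4 → Fin 4}
    (hπ : Function.Injective π) : cayley z (frameTuple (unitaryFrame u m ∘ π) 4) = 1 := by
  have h := half_sq_add_frameTuple hω hπ (reOmega_unitaryFrame π)
  unfold cayley
  exact h

/-- Both the `Spin(7)` instanton equation and the Hermitian Yang-Mills equations force the trace of
a two-form of type `(1,1)` to vanish; the squared norm is the sum of the squared eigenvalues. -/
theorem trace_and_norm (hz : z ∈ X)
    (hν : ∀ i j, herm (u i : E) (u j : E) = if i = j then (ν i : ℂ) else 0)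
    (hl : ∀ i, herm z (u i : E) = (l i : ℂ)) (hll : ∀ i j, i ≠ j → l i * l j = 0)
    (hm : ∀ i, 0 < m i)
    (hmω : ∀ i, m i = deriv kp (radiusSq z) * l i ^ 2 + kp (radiusSq z) * ν i)
    {α : tangent z [⋀^Fin 2]→ₗ[ℝ] ℝ} {p q : ℝ}
    (hα : ∀ v w : tangent z, α ![v, w] = radialTwoForm p q z v w) :
    (hodgeStar (metric z) (vol z) α = -wedge (cayley z) α ∨
        wedge α (hodgeStar (metric z) (vol z) (omega z)) = 0 →
      ∑ i, (p * l i ^ 2 + q * ν i) / m i = 0) ∧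
    formNormSq (metric z) α = ∑ i, ((p * l i ^ 2 + q * ν i) / m i) ^ 2 := by
  have hω := isDiagonal_omega hν hl hll hm hmω
  have hd := isDiagonal_unitaryFrame hν hl hll hm hα
  obtain ⟨e, he⟩ := exists_basis_unitaryFrame hz hω
  have hg : ∀ a b, metricL z (e a) (e b) = if a = b then 1 else 0 := by
    intro a b
    rw [he, he, metricL_unitaryFrame hω]
  have hvol : ∀ π : Fin 4 → Fin 4, Function.Injective π →
      vol z (frameTuple (unitaryFrame u m ∘ π) 8) = 1 := by
    intro π hπ
    have h := vol_frame hω hπ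
    generalize vol z = ψ at h ⊢
    exact h
  refine ⟨?_, formNormSq_frame (metricL z) e he hg hd⟩
  rintro (h | h)
  · exact trace_eq_zero_of_hodgeStar_eq (metricL z) e he hg hvol hd
      (fun π hπ => cayley_frame hω hπ) h
  · exact trace_eq_zero_of_wedge_hodgeStar (metricL z) e he hg hω hvol hd h

end Frame

theorem herm_velocity_self {t : ℝ} (ht : 1 < t) :
    herm (velocity t) (velocity t) = ((t / (4 * (t ^ 2 - 1)) : ℝ) : ℂ) := by
  have h1 : √((t + 1) / 2) ^ 2 = (t + 1) / 2 := Real.sq_sqrt (by linarith)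
  have h2 : √((t - 1) / 2) ^ 2 = (t - 1) / 2 := Real.sq_sqrt (by linarith)
  have h3 : t + 1 ≠ 0 := by linarith
  have h4 : t - 1 ≠ 0 := by linarith
  have h5 : radiusSq (velocity t) = t / (4 * (t ^ 2 - 1)) := by
    simp only [radiusSq, velocity, Fin.sum_univ_five, Matrix.cons_val, map_mul,
      Complex.normSq_ofReal, Complex.normSq_I, map_zero]
    rw [← sq, ← sq, inv_pow, inv_pow, mul_pow, mul_pow, h1, h2,
      show t ^ 2 - 1 = (t + 1) * (t - 1) by ring]
    field_simp
    ring
  rw [herm_self, h5]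

/-- The fourth eigenvalue of the Stenzel metric in the frame `e₃, e₄, e₅, ∂ₜ` is positive. -/
theorem kp_radial_pos {t : ℝ} (ht : 1 < t) :
    0 < deriv kp t / 4 + kp t * (t / (4 * (t ^ 2 - 1))) := by
  have hk := kp_pos (t := t) (by linarith)
  have h4 : 0 < t - 1 := by linarith
  have h : deriv kp t / 4 + kp t * (t / (4 * (t ^ 2 - 1))) =
      kp t * (3 * (t + 1) / (16 * (t + 2) * (t - 1))) := by
    rw [(hasDerivAt_kp (by linarith)).deriv, show t ^ 2 - 1 = (t + 1) * (t - 1) by ring]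
    have : t + 1 ≠ 0 := by linarith
    have : t + 2 ≠ 0 := by linarith
    field_simp
    ring
  rw [h]
  positivity

/-- The linear algebra of the instanton equations at a point of `X ∖ S⁴`: a radial two-form has a
triple eigenvalue `q / 𝓕'` and one further eigenvalue. -/
theorem trace_and_norm_radial {z : E} (hz : z ∈ X \ S4) {α : tangent z [⋀^Fin 2]→ₗ[ℝ] ℝ}
    {p q : ℝ} (hα : ∀ v w : tangent z, α ![v, w] = radialTwoForm p q z v w) :
    (hodgeStar (metric z) (vol z) α = -wedge (cayley z) α ∨
        wedge α (hodgeStar (metric z) (vol z) (omega z)) = 0 →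
      3 * (q / kp (radiusSq z)) +
        (p / 4 + q * (radiusSq z / (4 * (radiusSq z ^ 2 - 1)))) /
          (deriv kp (radiusSq z) / 4 + kp (radiusSq z) *
            (radiusSq z / (4 * (radiusSq z ^ 2 - 1)))) = 0) ∧
    formNormSq (metric z) α = 3 * (q / kp (radiusSq z)) ^ 2 +
        ((p / 4 + q * (radiusSq z / (4 * (radiusSq z ^ 2 - 1)))) /
          (deriv kp (radiusSq z) / 4 + kp (radiusSq z) *
            (radiusSq z / (4 * (radiusSq z ^ 2 - 1))))) ^ 2 := by
  obtain ⟨hX, ht⟩ := mem_X_diff_S4_iff.1 hz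
  obtain ⟨h, hh, hzh⟩ := exists_act_crossSection hX
  have hv := velocity_mem_tangent ht
  have hhv := herm_velocity ht
  have hvv := herm_velocity_self ht
  have hm3 := kp_radial_pos ht
  have hk := kp_pos (t := radiusSq z) (by linarith)
  have hvel : ∀ j : Fin 5, 1 < j → velocity (radiusSq z) j = 0 := by
    intro j hj
    fin_cases j <;> first | rfl | exact absurd hj (by decide)
  set t := radiusSq z with ht'
  let u' : Fin 4 → E := ![Pi.single 2 1, Pi.single 3 1, Pi.single 4 1, velocity t]
  let ν : Fin 4 → ℝ := ![1, 1, 1, t / (4 * (t ^ 2 - 1))]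
  let l : Fin 4 → ℝ := ![0, 0, 0, 1 / 2]
  let m : Fin 4 → ℝ := fun i => deriv kp t * l i ^ 2 + kp t * ν i
  have hsingle : ∀ (j : Fin 5) (w : E), herm (Pi.single j 1) w = w j := by
    intro j w
    rw [herm, Finset.sum_eq_single j (fun k _ hk => by simp [hk]) (by simp)]
    simp
  have hsingle' : ∀ (j : Fin 5) (w : E), herm w (Pi.single j 1) = (starRingEnd ℂ) (w j) := by
    intro j w
    rw [herm, Finset.sum_eq_single j (fun k _ hk => by simp [hk]) (by simp)]
    simp
  have hu' : ∀ i, u' i ∈ tangent (crossSection t) := by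
    intro i
    fin_cases i
    · exact mem_tangent_iff.2 (by rw [bil_crossSection_left]; simp [u'])
    · exact mem_tangent_iff.2 (by rw [bil_crossSection_left]; simp [u'])
    · exact mem_tangent_iff.2 (by rw [bil_crossSection_left]; simp [u'])
    · exact hv
  have hu : ∀ i, act h (u' i) ∈ tangent z := by
    intro i
    rw [mem_tangent_iff, hzh, bil_act hh]
    exact hu' i
  have hν : ∀ i j, herm (act h (u' i)) (act h (u' j)) = if i = j then (ν i : ℂ) else 0 := by
    intro i j
    rw [herm_act hh]
    fin_cases i <;> fin_cases j <;> simp [u', ν, hsingle, hsingle', hvel]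
    rw [hvv]
    simp
  have hl : ∀ i, herm z (act h (u' i)) = (l i : ℂ) := by
    intro i
    rw [hzh, herm_act hh]
    fin_cases i
    · simp [u', l, hsingle', crossSection]
    · simp [u', l, hsingle', crossSection]
    · simp [u', l, hsingle', crossSection]
    · simpa [u', l] using hhv
  have hll : ∀ i j, i ≠ j → l i * l j = 0 := by
    intro i j hij
    fin_cases i <;> fin_cases j <;> simp [l] at hij ⊢
  have hm : ∀ i, 0 < m i := by
    intro i
    fin_cases i
    · simpa [m, ν, l] using hk
    · simpa [m, ν, l] using hk
    · simpa [m, ν, l] using hk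
    · change 0 < deriv kp t * (1 / 2) ^ 2 + kp t * (t / (4 * (t ^ 2 - 1)))
      linarith
  obtain ⟨h1, h2⟩ := trace_and_norm (u := fun i => ⟨act h (u' i), hu i⟩) (m := m) hX hν hl hll hm
    (fun i => rfl) hα
  have e : ∀ i, (p * l i ^ 2 + q * ν i) / m i = ![q / kp t, q / kp t, q / kp t,
      (p / 4 + q * (t / (4 * (t ^ 2 - 1)))) /
        (deriv kp t / 4 + kp t * (t / (4 * (t ^ 2 - 1))))] i := by
    intro i
    fin_cases i
    · simp [m, ν, l]
    · simp [m, ν, l]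
    · simp [m, ν, l]
    · change (p * (1 / 2) ^ 2 + q * (t / (4 * (t ^ 2 - 1)))) /
        (deriv kp t * (1 / 2) ^ 2 + kp t * (t / (4 * (t ^ 2 - 1)))) = (_ / _ : ℝ)
      congr 1 <;> ring
  simp only [e, Fin.sum_univ_four, Matrix.cons_val] at h1 h2
  refine ⟨fun h0 => ?_, ?_⟩
  · rw [← h1 h0]
    ring
  · rw [h2]
    ring

/-! ### The curvature of an invariant connection -/

section Curvature

variable {a : OneForm}

theorem contDiffOn_coeff (hc : IsConnection (X \ S4) a) :
    ContDiffOn ℝ ∞ (radialCoeff a) (Ioi 1) ∧ ContDiffOn ℝ ∞ (angularCoeff a) (Ioi 1) := by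
  obtain ⟨W, -, hMW, ha⟩ := hc
  have h1 : ContDiffOn ℝ ∞ (fun t => toForm.symm (a (crossSection t))) (Ioi 1) :=
    toForm.symm.contDiff.comp_contDiffOn
      (ha.comp contDiffOn_crossSection fun t ht => hMW (crossSection_mem ht))
  have h2 : ContDiffOn ℝ ∞ (fun t => Complex.I • velocity t) (Ioi 1) :=
    contDiffOn_velocity.const_smul Complex.I
  constructor
  · exact (h1.clm_apply contDiffOn_velocity).congr fun t _ => (toForm_symm_apply _ _).symm
  · exact (contDiffOn_const.mul (h1.clm_apply h2)).congr fun t _ => by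
      rw [angularCoeff, toForm_symm_apply]

theorem isOpen_one_lt_radiusSq : IsOpen {z : E | 1 < radiusSq z} :=
  isOpen_lt continuous_const
    (continuous_iff_continuousAt.2 fun z => (hasFDerivAt_radiusSq z).continuousAt)

theorem IsConnection.differentiableAt {M : Set E} (hc : IsConnection M a) {z : E} (hz : z ∈ M) :
    DifferentiableAt ℝ a z := by
  obtain ⟨W, hW, hMW, ha⟩ := hc
  exact (ha.contDiffAt (hW.mem_nhds (hMW hz))).differentiableAt (by simp)

/-- The curvature of an invariant connection is a radial two-form determined by its angular
coefficient. -/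
theorem extDeriv_of_isInvariant (hc : IsConnection (X \ S4) a) (ha : IsInvariant (X \ S4) a)
    {z v w : E} (hz : z ∈ X \ S4) (hv : v ∈ tangent z) (hw : w ∈ tangent z) :
    extDeriv a z ![v, w] = radialTwoForm (2 * deriv (angularCoeff a) (radiusSq z))
      (2 * angularCoeff a (radiusSq z)) z v w := by
  obtain ⟨hX, ht⟩ := mem_X_diff_S4_iff.1 hz
  obtain ⟨hP, hG⟩ := contDiffOn_coeff hc
  have hP' := ((hP.contDiffAt (Ioi_mem_nhds ht)).differentiableAt (by simp)).hasDerivAt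
  have hG' := ((hG.contDiffAt (Ioi_mem_nhds ht)).differentiableAt (by simp)).hasDerivAt
  obtain ⟨d1, e1⟩ := extDeriv_radial imL hG'
  obtain ⟨d2, e2⟩ := extDeriv_radial reL (hP'.const_mul 2)
  have d3 := hc.differentiableAt hz
  have h0 := extDeriv_congr_of_tangent (b := fun w =>
    toForm (angularCoeff a (radiusSq w) • imL w) +
      toForm ((2 * radialCoeff a (radiusSq w)) • reL w)) hX d3 (d1.add d2) (by
    filter_upwards [isOpen_one_lt_radiusSq.mem_nhds ht] with y hy hyX u hu
    have h := ha.eq_radial (mem_X_diff_S4_iff.2 ⟨hyX, hy⟩) hu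
    change a y ![u] = angularCoeff a (radiusSq y) * imL y u +
      2 * radialCoeff a (radiusSq y) * reL y u
    rw [h]
    ring) hv hw
  rw [h0, extDeriv_fun_add d1 d2, ContinuousAlternatingMap.add_apply, e1, e2,
    reL_symm w v, imL_antisymm w v, radialTwoForm]
  ring

theorem curvature_apply (hc : IsConnection (X \ S4) a) (ha : IsInvariant (X \ S4) a)
    {z : E} (hz : z ∈ X \ S4) (v w : tangent z) :
    curvature a z ![v, w] = radialTwoForm (2 * deriv (angularCoeff a) (radiusSq z))
      (2 * angularCoeff a (radiusSq z)) z v w :=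
  (restrict_apply_pair z _ v w).trans (extDeriv_of_isInvariant hc ha hz v.2 w.2)

/-- Both the `Spin(7)` instanton and the Hermitian Yang-Mills equations force `3 λ₁ + λ₄ = 0` for
the eigenvalues of the curvature, which is a linear ordinary differential equation for the angular
coefficient. -/
theorem exists_angularCoeff_mul_eq (hc : IsConnection (X \ S4) a) (ha : IsInvariant (X \ S4) a)
    (hi : IsSpin7Instanton (X \ S4) a ∨ IsHYM (X \ S4) a) :
    ∃ C : ℝ, (∀ t, 1 < t → angularCoeff a t * (kp t ^ 3 * (t ^ 2 - 1) ^ 2) = C) ∧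
      ∀ z ∈ X \ S4, curvatureNormSq a z =
        48 * (angularCoeff a (radiusSq z) / kp (radiusSq z)) ^ 2 := by
  have key : ∀ z ∈ X \ S4, _ := fun z hz =>
    trace_and_norm_radial hz (curvature_apply hc ha hz)
  have tr : ∀ z, (hz : z ∈ X \ S4) → _ := fun z hz => (key z hz).1 (by
    rcases hi with h | h
    · exact Or.inl (h z hz)
    · exact Or.inr (h z hz).1)
  have hG := (contDiffOn_coeff hc).2
  have hd : ∀ t, 1 < t → HasDerivAt
      (fun t => angularCoeff a t * (kp t ^ 3 * (t ^ 2 - 1) ^ 2)) 0 t := by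
    intro t ht
    have h := tr (crossSection t) (crossSection_mem ht)
    rw [radiusSq_crossSection ht.le] at h
    have hpos := kp_radial_pos ht
    have hk := kp_pos (t := t) (by linarith)
    have hk' := hasDerivAt_kp (t := t) (by linarith)
    have hG' := ((hG.contDiffAt (Ioi_mem_nhds ht)).differentiableAt (by simp)).hasDerivAt
    rw [← hk'.deriv] at hk'
    have h3 : HasDerivAt (fun t => kp t ^ 3 * (t ^ 2 - 1) ^ 2) _ t :=
      (hk'.pow 3).mul ((((hasDerivAt_id t).pow 2).sub_const 1).pow 2)
    refine (hG'.mul h3).congr_deriv ?_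
    simp only [id, Nat.cast_ofNat]
    have ht1 : t ^ 2 - 1 ≠ 0 := by nlinarith
    have hone : (t ^ 2 - 1) * (t / (4 * (t ^ 2 - 1))) = t / 4 := by field_simp
    generalize t / (4 * (t ^ 2 - 1)) = n at h hpos hone
    -- The trace condition, cleared of denominators, is the vanishing of the derivative.
    have h4 : 6 * angularCoeff a t * (deriv kp t / 4 + kp t * n) +
        kp t * (deriv (angularCoeff a) t / 2 + 2 * angularCoeff a t * n) = 0 := by
      generalize deriv kp t / 4 + kp t * n = D at h hpos
      field_simp at h
      linear_combination h / 4
    simp only [Pi.pow_apply, id]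
    linear_combination (2 * (t ^ 2 - 1) ^ 2 * kp t ^ 2) * h4 -
      16 * (t ^ 2 - 1) * kp t ^ 3 * angularCoeff a t * hone
  have hconst : ∀ t, 1 < t → angularCoeff a t * (kp t ^ 3 * (t ^ 2 - 1) ^ 2) =
      angularCoeff a 2 * (kp 2 ^ 3 * (2 ^ 2 - 1) ^ 2) := by
    intro t ht
    exact isOpen_Ioi.is_const_of_deriv_eq_zero isPreconnected_Ioi
      (fun s hs => (hd s hs).differentiableAt.differentiableWithinAt)
      (fun s hs => (hd s hs).deriv) ht (by norm_num : (1 : ℝ) < 2)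
  refine ⟨_, hconst, fun z hz => ?_⟩
  have h1 := tr z hz
  rw [curvatureNormSq, (key z hz).2, eq_neg_of_add_eq_zero_right h1]
  ring

theorem angularCoeff_eq_zero
    (h : ∀ t, 1 < t → angularCoeff a t * (kp t ^ 3 * (t ^ 2 - 1) ^ 2) = 0) {t : ℝ} (ht : 1 < t) :
    angularCoeff a t = 0 := by
  have hk := kp_pos (t := t) (by linarith)
  have h1 : 0 < t ^ 2 - 1 := by nlinarith
  exact (mul_eq_zero.1 (h t ht)).resolve_right (by positivity)

end Curvature

/-! ### Gauge transformations -/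

theorem hasFDerivAt_exp_phase {φ : E → ℝ} {φ' : E →L[ℝ] ℝ} {z : E} (h : HasFDerivAt φ φ' z) :
    HasFDerivAt (fun w => Complex.exp (Complex.I * (φ w : ℂ)))
      (Complex.exp (Complex.I * (φ z : ℂ)) • Complex.I • Complex.ofRealCLM.comp φ') z :=
  ((Complex.ofRealCLM.hasFDerivAt.comp z h).const_mul Complex.I).cexp

/-- A connection whose restriction to `M` is the differential of an invariant function is trivial:
the function is the phase of a gauge transformation. -/
theorem isTrivialConnection_of_phase {M W : Set E} {a : OneForm} {φ : E → ℝ} (hW : IsOpen W)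
    (hMW : M ⊆ W) (hφ : ContDiffOn ℝ ∞ φ W)
    (hinv : ∀ h ∈ Matrix.specialOrthogonalGroup (Fin 5) ℝ, ∀ z ∈ M, φ (act h z) = φ z)
    (hd : ∀ z ∈ M, ∀ v ∈ tangent z, a z ![v] = fderiv ℝ φ z v) : IsTrivialConnection M a := by
  refine ⟨fun w => Complex.exp (Complex.I * (φ w : ℂ)), ⟨⟨W, hW, hMW, ?_⟩, fun z _ => ?_⟩, ?_, ?_⟩
  · exact (contDiffOn_const.mul (Complex.ofRealCLM.contDiff.comp_contDiffOn hφ)).cexp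
  · change ‖Complex.exp (Complex.I * (φ z : ℂ))‖ = 1
    rw [mul_comm, Complex.norm_exp_ofReal_mul_I]
  · intro h hh z hz
    simp only [hinv h hh z hz]
  · intro z hz v hv
    have h1 := ((hφ.contDiffAt (hW.mem_nhds (hMW hz))).differentiableAt (by simp)).hasFDerivAt
    rw [(hasFDerivAt_exp_phase h1).fderiv, hd z hz v hv]
    change _ = Complex.I * ((0 : ℝ) : ℂ) + _ * (Complex.exp (Complex.I * (φ z : ℂ)) *
      (Complex.I * ((fderiv ℝ φ z v : ℝ) : ℂ)))
    rw [← mul_assoc (_⁻¹), inv_mul_cancel₀ (Complex.exp_ne_zero _)]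
    simp

theorem contDiff_radiusSq : ContDiff ℝ ∞ radiusSq := by
  have h : radiusSq = fun w => reL w w := funext radiusSq_eq
  rw [h]
  exact reL.contDiff.clm_apply contDiff_id

theorem exists_primitive {P : ℝ → ℝ} (hP : ContDiffOn ℝ ∞ P (Ioi 1)) :
    ∃ H : ℝ → ℝ, ContDiffOn ℝ ∞ H (Ioi 1) ∧ ∀ t, 1 < t → HasDerivAt H (P t) t := by
  have hd : ∀ t, 1 < t → HasDerivAt (fun t => ∫ s in (2 : ℝ)..t, P s) (P t) t := by
    intro t ht
    have hsub : uIcc 2 t ⊆ Ioi 1 := by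
      intro s hs
      rcases mem_uIcc.1 hs with h | h
      · exact lt_of_lt_of_le (by norm_num) h.1
      · exact lt_of_lt_of_le ht h.1
    exact intervalIntegral.integral_hasDerivAt_right
      ((hP.continuousOn.mono hsub).intervalIntegrable)
      (hP.continuousOn.stronglyMeasurableAtFilter isOpen_Ioi t ht)
      (hP.continuousOn.continuousAt (Ioi_mem_nhds ht))
  refine ⟨_, (contDiffOn_infty_iff_deriv_of_isOpen isOpen_Ioi).2 ⟨fun t ht =>
    (hd t ht).differentiableAt.differentiableWithinAt, hP.congr fun t ht => (hd t ht).deriv⟩, hd⟩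

/-- An invariant connection without angular part is `P(r²) d(r²)`, hence exact and trivial. -/
theorem isTrivialConnection_of_angularCoeff_eq_zero {a : OneForm} (hc : IsConnection (X \ S4) a)
    (ha : IsInvariant (X \ S4) a) (h0 : ∀ t, 1 < t → angularCoeff a t = 0) :
    IsTrivialConnection (X \ S4) a := by
  obtain ⟨H, hH, hd⟩ := exists_primitive (contDiffOn_coeff hc).1
  refine isTrivialConnection_of_phase (φ := fun w => H (radiusSq w)) isOpen_one_lt_radiusSq
    (fun z hz => (mem_X_diff_S4_iff.1 hz).2)
    (hH.comp contDiff_radiusSq.contDiffOn fun z hz => hz) ?_ ?_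
  · intro h hh z _
    simp only [radiusSq_act hh]
  · intro z hz v hv
    have ht := (mem_X_diff_S4_iff.1 hz).2
    have h1 : HasFDerivAt (fun w => H (radiusSq w)) _ z :=
      (hd _ ht).comp_hasFDerivAt z (hasFDerivAt_radiusSq z)
    rw [h1.fderiv, ha.eq_radial hz hv, h0 _ ht]
    simp

/-- Exact forms are closed. -/
theorem extDeriv_fderiv {θ : E → ℝ} {z : E} (hθ : ContDiffAt ℝ ∞ θ z) :
    DifferentiableAt ℝ (fun w => toForm (fderiv ℝ θ w)) z ∧
      ∀ v w : E, extDeriv (fun w => toForm (fderiv ℝ θ w)) z ![v, w] = 0 := by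
  have h1 : DifferentiableAt ℝ (fderiv ℝ θ) z :=
    (hθ.fderiv_right (m := 1)
      (by exact WithTop.coe_le_coe.2 (le_top : (2 : ℕ∞) ≤ ⊤))).differentiableAt (by simp)
  have h2 : HasFDerivAt (fun w => toForm (fderiv ℝ θ w)) _ z :=
    (toForm.toContinuousLinearEquiv : (E →L[ℝ] ℝ) →L[ℝ] (E [⋀^Fin 1]→L[ℝ] ℝ)).hasFDerivAt.comp z
      h1.hasFDerivAt
  refine ⟨h2.differentiableAt, fun v w => ?_⟩
  rw [extDeriv_apply_pair h2.differentiableAt, h2.fderiv]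
  change fderiv ℝ (fderiv ℝ θ) z v w - fderiv ℝ (fderiv ℝ θ) z w v = 0
  have h3 := hθ.isSymmSndFDerivAt (by
    rw [minSmoothness_of_isRCLikeNormedField]
    exact WithTop.coe_le_coe.2 (le_top : (2 : ℕ∞) ≤ ⊤))
  rw [h3 v w, sub_self]

/-- Curvature is gauge invariant: `u⁻¹ du` is locally the differential of a logarithm of `u`. -/
theorem extDeriv_eq_of_gaugeRelated {a b : OneForm} {u : E → ℂ} (hu : IsGauge (X \ S4) u)
    (hg : GaugeRelated (X \ S4) u a b) {z v w : E} (hz : z ∈ X \ S4)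
    (ha : DifferentiableAt ℝ a z) (hb : DifferentiableAt ℝ b z) (hv : v ∈ tangent z)
    (hw : w ∈ tangent z) : extDeriv b z ![v, w] = extDeriv a z ![v, w] := by
  obtain ⟨⟨W, hW, hMW, hcu⟩, hnorm⟩ := hu
  have hzW := hMW hz
  have hu0 : u z ≠ 0 := by
    intro h
    have h1 := hnorm z hz
    rw [h, norm_zero] at h1
    exact zero_ne_one h1
  let q : E → ℂ := fun y => (u z)⁻¹ * u y
  have hq : ContDiffOn ℝ ∞ q W := contDiffOn_const.mul hcu
  have hqz : q z = 1 := inv_mul_cancel₀ hu0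
  -- On `W'` the quotient `u / u(z)` stays in the domain of the principal logarithm.
  have hW' : IsOpen (W ∩ q ⁻¹' Complex.slitPlane) :=
    hq.continuousOn.isOpen_inter_preimage hW Complex.isOpen_slitPlane
  have hzW' : z ∈ W ∩ q ⁻¹' Complex.slitPlane :=
    ⟨hzW, by rw [mem_preimage, hqz]; exact Complex.one_mem_slitPlane⟩
  let θ : E → ℝ := fun y => (Complex.log (q y)).im
  have hθ : ContDiffAt ℝ ∞ θ z := by
    have h1 : ContDiffAt ℝ ∞ Complex.log (q z) :=
      (Complex.contDiffAt_log hzW'.2).restrict_scalars ℝ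
    exact Complex.imCLM.contDiff.contDiffAt.comp z
      (h1.comp z (hq.contDiffAt (hW.mem_nhds hzW)))
  have hθ' : ∀ y ∈ W ∩ q ⁻¹' Complex.slitPlane, ∀ v : E,
      fderiv ℝ θ y v = ((u y)⁻¹ * fderiv ℝ u y v).im := by
    intro y hy v
    have h1 := ((hcu.contDiffAt (hW.mem_nhds hy.1)).differentiableAt (by simp)).hasFDerivAt
    have h2 : HasFDerivAt q _ y := h1.const_mul (u z)⁻¹
    have h3 := ((Complex.hasDerivAt_log hy.2).hasFDerivAt.restrictScalars ℝ).comp y h2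
    have h4 : HasFDerivAt θ _ y := Complex.imCLM.hasFDerivAt.comp y h3
    rw [h4.fderiv]
    change ((u z)⁻¹ * fderiv ℝ u y v * (q y)⁻¹).im = _
    congr 1
    simp only [q]
    rw [mul_inv, inv_inv]
    field_simp
  obtain ⟨d1, e1⟩ := extDeriv_fderiv hθ
  have h0 := extDeriv_congr_of_tangent (b := fun y => a y + toForm (fderiv ℝ θ y)) hz.1 hb
    (ha.add d1) (by
    filter_upwards [hW'.mem_nhds hzW',
      isOpen_one_lt_radiusSq.mem_nhds (mem_X_diff_S4_iff.1 hz).2] with y hy hy1 hyX v hv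
    have h1 := congrArg Complex.im (hg y (mem_X_diff_S4_iff.2 ⟨hyX, hy1⟩) v hv)
    rw [Complex.add_im, ← hθ' y hy] at h1
    change b y ![v] = a y ![v] + fderiv ℝ θ y v
    simpa using h1) hv hw
  rw [h0, extDeriv_fun_add ha d1, ContinuousAlternatingMap.add_apply, e1, add_zero]

/-! ### The singularity along `S⁴` -/

theorem tendsto_comap_radius {f : ℝ → ℝ} (hf : ContinuousAt f 1) :
    Tendsto (fun z => f (radius z)) (comap radius (𝓝[>] 1) ⊓ 𝓟 X) (𝓝 (f 1)) :=
  ((hf.tendsto.mono_left nhdsWithin_le_nhds).comp tendsto_comap).mono_left inf_le_left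

theorem eventually_mem_X_diff_S4 :
    ∀ᶠ z in comap radius (𝓝[>] 1) ⊓ 𝓟 X, 1 < radius z ∧ z ∈ X \ S4 := by
  have h1 : ∀ᶠ z in comap radius (𝓝[>] 1) ⊓ 𝓟 X, 1 < radius z :=
    (tendsto_comap.eventually (eventually_mem_nhdsWithin)).filter_mono inf_le_left
  have h2 : ∀ᶠ z in comap radius (𝓝[>] 1) ⊓ 𝓟 X, z ∈ X :=
    (eventually_principal.2 fun z hz => hz).filter_mono inf_le_right
  filter_upwards [h1, h2] with z hz hzX
  refine ⟨hz, mem_X_diff_S4_iff.2 ⟨hzX, ?_⟩⟩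
  have h3 : radius z ^ 2 = radiusSq z := Real.sq_sqrt (radiusSq_nonneg z)
  nlinarith

/-- The curvature `48 C² (r⁴ - 1)⁻⁴ 𝓕'(r²)⁻⁸` has a pole of order four at `r = 1`. -/
theorem tendsto_curvatureNormSq {a : OneForm} {C : ℝ}
    (hG : ∀ t, 1 < t → angularCoeff a t * (kp t ^ 3 * (t ^ 2 - 1) ^ 2) = C)
    (hn : ∀ z ∈ X \ S4, curvatureNormSq a z =
        48 * (angularCoeff a (radiusSq z) / kp (radiusSq z)) ^ 2) :
    Tendsto (fun z => |radius z - 1| ^ 4 * curvatureNormSq a z)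
      (comap radius (𝓝[>] 1) ⊓ 𝓟 X) (𝓝 (48 * C ^ 2 / 256)) := by
  let f : ℝ → ℝ := fun r => 48 * C ^ 2 / (kp (r ^ 2) ^ 8 * ((r + 1) * (r ^ 2 + 1)) ^ 4)
  have hkp : ContinuousAt (fun r : ℝ => kp (r ^ 2)) 1 := by
    refine ContinuousAt.comp (f := fun r : ℝ => r ^ 2) (g := kp) ?_ (by fun_prop)
    exact (hasDerivAt_kp (by norm_num)).continuousAt
  have hf : ContinuousAt f 1 := by
    refine ContinuousAt.div (by fun_prop) (by fun_prop) ?_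
    norm_num [kp_one]
  have h1 : f 1 = 48 * C ^ 2 / 256 := by
    norm_num [f, kp_one]
  rw [← h1]
  refine (tendsto_comap_radius hf).congr' ?_
  filter_upwards [eventually_mem_X_diff_S4] with z hz
  have h3 : radiusSq z = radius z ^ 2 := (Real.sq_sqrt (radiusSq_nonneg z)).symm
  rw [hn z hz.2, h3]
  set r := radius z
  have hr : 1 < r ^ 2 := by nlinarith [hz.1]
  have hk := kp_pos (t := r ^ 2) (by linarith)
  have h4 : r - 1 ≠ 0 := by linarith [hz.1]
  have h5 : r + 1 ≠ 0 := by linarith [hz.1]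
  have h6 : r ^ 2 + 1 ≠ 0 := by linarith
  simp only [f]
  rw [← hG _ hr, show (r ^ 2) ^ 2 - 1 = (r - 1) * ((r + 1) * (r ^ 2 + 1)) by ring,
    show |r - 1| ^ 4 = (r - 1) ^ 4 by rw [abs_of_pos (by linarith [hz.1])]]
  field_simp

/-- If the curvature extends continuously over `S⁴`, the constant `C` vanishes: in the directions
`e₃, i e₃` the curvature along the cross-section is `2 G(t)`, which would blow up as `t → 1`. -/
theorem eq_zero_of_curvature_extends {a b : OneForm} {C : ℝ} (hb : IsConnection X b)
    (hF : ∀ z ∈ X \ S4, ∀ v ∈ tangent z, ∀ w ∈ tangent z, extDeriv b z ![v, w] =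
      radialTwoForm (2 * deriv (angularCoeff a) (radiusSq z))
        (2 * angularCoeff a (radiusSq z)) z v w)
    (hG : ∀ t, 1 < t → angularCoeff a t * (kp t ^ 3 * (t ^ 2 - 1) ^ 2) = C) : C = 0 := by
  let e : E := Pi.single 2 1
  let k : ℝ → ℝ := fun t => extDeriv b (crossSection t) ![e, Complex.I • e]
  have hk : ContinuousAt k 1 := by
    obtain ⟨W, hW, hXW, hbW⟩ := hb
    have hmem : W ∈ 𝓝 (crossSection 1) := hW.mem_nhds (hXW (crossSection_mem_X le_rfl))
    have h1 : ContinuousAt (extDeriv b) (crossSection 1) := by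
      have h2 : ContinuousAt (fderiv ℝ b) (crossSection 1) :=
        ((hbW.contDiffAt hmem).fderiv_right (m := 0) (by simp)).continuousAt
      exact (ContinuousAlternatingMap.alternatizeUncurryFinCLM ℝ E ℝ).continuous.continuousAt.comp
        h2
    have h3 : ContinuousAt (fun t => extDeriv b (crossSection t)) 1 :=
      ContinuousAt.comp (g := extDeriv b) h1 continuous_crossSection.continuousAt
    exact (ContinuousAlternatingMap.apply ℝ E ℝ ![e, Complex.I • e]).continuous.continuousAt.comp h3
  have hval : ∀ t, 1 < t → k t = 2 * angularCoeff a t := by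
    intro t ht
    have he : e ∈ tangent (crossSection t) :=
      mem_tangent_iff.2 (by rw [bil_crossSection_left]; simp [e])
    have h := hF _ (crossSection_mem ht) e he _ (I_smul_mem_tangent he)
    simp only [k]
    rw [h, radiusSq_crossSection ht.le, radialTwoForm]
    have h1 : herm (crossSection t) e = 0 := by rw [herm_crossSection]; simp [e]
    have h2 : herm e e = 1 := by rw [herm_self]; simp [radiusSq, e, Fin.sum_univ_five]
    simp [reL_apply, imL_apply, herm_smul_right, h1, h2]
  have hkp : ContinuousAt kp 1 := (hasDerivAt_kp (by norm_num)).continuousAt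
  have hlim : Tendsto (fun t => k t / 2 * (kp t ^ 3 * (t ^ 2 - 1) ^ 2)) (𝓝[>] 1) (𝓝 0) := by
    have h1 : ContinuousAt (fun t => k t / 2 * (kp t ^ 3 * (t ^ 2 - 1) ^ 2)) 1 := by fun_prop
    have h2 := h1.tendsto.mono_left (nhdsWithin_le_nhds (s := Ioi 1))
    simpa using h2
  have hconst : Tendsto (fun t => k t / 2 * (kp t ^ 3 * (t ^ 2 - 1) ^ 2)) (𝓝[>] 1) (𝓝 C) := by
    refine tendsto_const_nhds.congr' ?_
    filter_upwards [self_mem_nhdsWithin] with t ht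
    rw [hval t ht, ← hG t ht]
    ring
  exact tendsto_nhds_unique hconst hlim

theorem curvature_singular_of_not_trivial {a : OneForm} (hc : IsConnection (X \ S4) a)
    (ha : IsInvariant (X \ S4) a) (hi : IsSpin7Instanton (X \ S4) a ∨ IsHYM (X \ S4) a)
    (hnt : ¬ IsTrivialConnection (X \ S4) a) :
    (∃ L : ℝ, 0 < L ∧ Tendsto (fun z => |radius z - 1| ^ 4 * curvatureNormSq a z)
      (comap radius (𝓝[>] 1) ⊓ 𝓟 X) (𝓝 L)) ∧
    Tendsto (curvatureNormSq a) (comap radius (𝓝[>] 1) ⊓ 𝓟 X) atTop ∧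
    ¬ ∃ (b : OneForm) (u : E → ℂ), IsConnection X b ∧ IsGauge (X \ S4) u ∧
      GaugeRelated (X \ S4) u a b := by
  obtain ⟨C, hG, hn⟩ := exists_angularCoeff_mul_eq hc ha hi
  have hC : C ≠ 0 := by
    rintro rfl
    exact hnt (isTrivialConnection_of_angularCoeff_eq_zero hc ha fun t ht =>
      angularCoeff_eq_zero hG ht)
  have hlim := tendsto_curvatureNormSq hG hn
  have hL : 0 < 48 * C ^ 2 / 256 := by positivity
  refine ⟨⟨_, hL, hlim⟩, ?_, ?_⟩
  · have h1 : Tendsto (fun z => (|radius z - 1| ^ 4)⁻¹) (comap radius (𝓝[>] 1) ⊓ 𝓟 X) atTop := by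
      refine tendsto_inv_nhdsGT_zero.comp (tendsto_nhdsWithin_iff.2 ⟨?_, ?_⟩)
      · have h2 := tendsto_comap_radius (f := fun r => |r - 1| ^ 4) (by fun_prop)
        simpa using h2
      · filter_upwards [eventually_mem_X_diff_S4] with z hz
        have h3 : radius z - 1 ≠ 0 := by linarith [hz.1]
        exact pow_pos (abs_pos.2 h3) 4
    refine (hlim.pos_mul_atTop hL h1).congr' ?_
    filter_upwards [eventually_mem_X_diff_S4] with z hz
    have h3 : radius z - 1 ≠ 0 := by linarith [hz.1]
    field_simp
  · rintro ⟨b, u, hb, hu, hg⟩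
    refine hC (eq_zero_of_curvature_extends hb (fun z hz v hv w hw => ?_) hG)
    rw [extDeriv_eq_of_gaugeRelated hu hg hz (hc.differentiableAt hz) (hb.differentiableAt hz.1)
      hv hw, extDeriv_of_isInvariant hc ha hz hv hw]

/-! ### Flat invariant connections on the whole quadric -/

/-- A smooth curve in `X` through the zero section which reparametrises the cross-section by
`t = 1 + 2 s²`. -/
def curve (s : ℝ) : E := ![(√(1 + s ^ 2) : ℝ), (s : ℂ) * Complex.I, 0, 0, 0]

/-- The derivative of `curve`. -/
def curveVelocity (s : ℝ) : E := ![(s / √(1 + s ^ 2) : ℝ), Complex.I, 0, 0, 0]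

theorem continuous_curve : Continuous curve := by
  refine continuous_pi fun j => ?_
  fin_cases j <;> simp [curve] <;> fun_prop

theorem continuous_curveVelocity : Continuous curveVelocity := by
  refine continuous_pi fun j => ?_
  have h : ∀ s : ℝ, √(1 + s ^ 2) ≠ 0 := fun s => Real.sqrt_ne_zero'.2 (by positivity)
  fin_cases j
  · exact Complex.continuous_ofReal.comp (continuous_id.div (by fun_prop) h)
  all_goals exact continuous_const

theorem curve_sqrt {t : ℝ} (ht : 1 ≤ t) : curve √((t - 1) / 2) = crossSection t := by
  rw [curve, crossSection, Real.sq_sqrt (by linarith), show 1 + (t - 1) / 2 = (t + 1) / 2 by ring]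

theorem curve_mem_X (s : ℝ) : curve s ∈ X := by
  have h1 : ((√(1 + s ^ 2) : ℝ) : ℂ) ^ 2 = ((1 + s ^ 2 : ℝ) : ℂ) := by
    rw [← Complex.ofReal_pow, Real.sq_sqrt (by positivity)]
  rw [mem_X_iff]
  simp only [bil, curve, Fin.sum_univ_five, Matrix.cons_val]
  push_cast at h1
  linear_combination h1 + (s : ℂ) ^ 2 * Complex.I_sq

theorem velocity_eq_smul {t : ℝ} (ht : 1 < t) :
    velocity t = (4 * √((t - 1) / 2))⁻¹ • curveVelocity √((t - 1) / 2) := by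
  have h1 : √((t + 1) / 2) ≠ 0 := Real.sqrt_ne_zero'.2 (by linarith)
  have h2 : √((t - 1) / 2) ≠ 0 := Real.sqrt_ne_zero'.2 (by linarith)
  have h3 : 1 + √((t - 1) / 2) ^ 2 = (t + 1) / 2 := by
    rw [Real.sq_sqrt (by linarith)]
    ring
  rw [velocity, curveVelocity, h3]
  generalize √((t + 1) / 2) = c at *
  generalize √((t - 1) / 2) = s at *
  funext j
  fin_cases j
  · have h4 : ((c : ℝ) : ℂ) ≠ 0 := Complex.ofReal_ne_zero.2 h1
    have h5 : ((s : ℝ) : ℂ) ≠ 0 := Complex.ofReal_ne_zero.2 h2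
    simp
    field_simp
  all_goals simp

/-- The radial coefficient of an invariant form on `X` has a primitive on `t ≥ 1` that vanishes at
`t = 1` to higher order than `√(t - 1)`. -/
theorem exists_primitive_radialCoeff {a : OneForm} (hc : IsConnection X a) (ha : IsInvariant X a) :
    ∃ K : ℝ → ℝ, HasDerivAt K 0 0 ∧ K 0 = 0 ∧
      ∀ t, 1 < t → HasDerivAt (fun t => K √((t - 1) / 2)) (radialCoeff a t) t := by
  obtain ⟨W, -, hXW, haW⟩ := hc
  let f : ℝ → ℝ := fun s => toForm.symm (a (curve s)) (curveVelocity s)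
  have hf : Continuous f := by
    have h1 : Continuous fun s => a (curve s) :=
      haW.continuousOn.comp_continuous continuous_curve fun s => hXW (curve_mem_X s)
    exact (toForm.symm.continuous.comp h1).clm_apply continuous_curveVelocity
  have hd : ∀ s, HasDerivAt (fun s => ∫ x in (0 : ℝ)..s, f x) (f s) s := fun s =>
    intervalIntegral.integral_hasDerivAt_right (hf.intervalIntegrable _ _)
      (hf.stronglyMeasurableAtFilter _ _) hf.continuousAt
  have hf0 : f 0 = 0 := by
    have h1 : curve 0 = crossSection 1 := by simp [curve, crossSection]
    have hX := crossSection_mem_X le_rfl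
    simp only [f]
    rw [toForm_symm_apply, h1]
    refine ha.eq_zero_of_mem_S4 ((mem_S4_iff hX).2 (radiusSq_crossSection le_rfl)) ?_
    rw [mem_tangent_iff, bil_crossSection_left]
    simp [curveVelocity]
  refine ⟨fun s => ∫ x in (0 : ℝ)..s, f x, ?_, intervalIntegral.integral_same, fun t ht => ?_⟩
  · have h := hd 0
    rwa [hf0] at h
  · have h2 : √((t - 1) / 2) ≠ 0 := Real.sqrt_ne_zero'.2 (by linarith)
    have h3 : HasDerivAt (fun t : ℝ => √((t - 1) / 2)) (4 * √((t - 1) / 2))⁻¹ t := by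
      refine ((((hasDerivAt_id t).sub_const 1).div_const 2).sqrt
        (by simp only [id]; linarith)).congr_deriv ?_
      simp only [id]
      field_simp
      norm_num
    refine ((hd _).comp t h3).congr_deriv ?_
    simp only [f]
    rw [curve_sqrt ht.le, radialCoeff, ← toForm_symm_apply, velocity_eq_smul ht, map_smul,
      smul_eq_mul, mul_comm]

theorem sqrt_half_eq_of_mem {z : E} (hz : z ∈ X) :
    √((radiusSq z - 1) / 2) = √(∑ j, (z j).im ^ 2) := by
  rw [(sum_sq_eq_of_mem hz).2]

/-- The distance to the zero section is controlled by the ambient norm. -/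
theorem sqrt_half_le {y z : E} (hy : y ∈ X) (hz : z ∈ S4) :
    √((radiusSq y - 1) / 2) ≤ √5 * ‖y - z‖ := by
  rw [sqrt_half_eq_of_mem hy]
  refine Real.sqrt_le_iff.2 ⟨by positivity, ?_⟩
  rw [mul_pow, Real.sq_sqrt (by norm_num)]
  have h : ∀ j, (y j).im ^ 2 ≤ ‖y - z‖ ^ 2 := by
    intro j
    have h1 : |((y - z) j).im| ≤ ‖y - z‖ := (Complex.abs_im_le_norm _).trans (norm_le_pi_norm _ j)
    have h2 : ((y - z) j).im = (y j).im := by simp [hz.2 j]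
    rw [h2] at h1
    rw [← sq_abs]
    exact pow_le_pow_left₀ (abs_nonneg _) h1 2
  calc ∑ j, (y j).im ^ 2 ≤ ∑ _j : Fin 5, ‖y - z‖ ^ 2 := Finset.sum_le_sum fun j _ => h j
    _ = 5 * ‖y - z‖ ^ 2 := by simp

theorem IsConnection.mono {M N : Set E} {a : OneForm} (h : M ⊆ N)
    (hc : IsConnection N a) : IsConnection M a := by
  obtain ⟨W, hW, hNW, haW⟩ := hc
  exact ⟨W, hW, h.trans hNW, haW⟩

theorem IsInvariant.mono {M N : Set E} {a : OneForm} (h : M ⊆ N) (ha : IsInvariant N a) :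
    IsInvariant M a := fun k hk z hz => ha k hk z (h hz)

/-- An invariant connection on `X` without angular part is exact: composed with the retraction, the
primitive of its radial coefficient is a smooth function, also across `S⁴`. -/
theorem isTrivialConnection_X_of_angularCoeff_eq_zero {a : OneForm} (hc : IsConnection X a)
    (ha : IsInvariant X a) (h0 : ∀ t, 1 < t → angularCoeff a t = 0) : IsTrivialConnection X a := by
  have ha' : IsInvariant (X \ S4) a := ha.mono sdiff_subset
  obtain ⟨K, hK0, hK, hKd⟩ := exists_primitive_radialCoeff hc ha
  obtain ⟨W, hW, hXW, haW⟩ := hc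
  let φ : E → ℝ := fun w => K √((radiusSq (retract w) - 1) / 2)
  have hρ : ∀ w ∈ domain, HasFDerivAt retract (fderiv ℝ retract w) w := fun w hw =>
    ((contDiffAt_retract hw).differentiableAt (by simp)).hasFDerivAt
  have hφ : ∀ w ∈ domain, HasFDerivAt φ
      ((toForm.symm (a (retract w))).comp (fderiv ℝ retract w)) w := by
    intro w hw
    have hX := retract_mem hw
    by_cases hS : retract w ∈ S4
    · have hzero : (toForm.symm (a (retract w))).comp (fderiv ℝ retract w) = 0 := by
        ext v
        rw [ContinuousLinearMap.comp_apply, toForm_symm_apply]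
        exact ha.eq_zero_of_mem_S4 hS (fderiv_retract_mem hw v)
      -- `φ = K ∘ s` with `K = o(s)` and `s` of the order of the distance to `S⁴`.
      have hO : (fun y => √((radiusSq (retract y) - 1) / 2)) =O[𝓝 w] fun y => y - w := by
        refine Asymptotics.IsBigO.trans ?_ (hρ w hw).isBigO_sub
        refine Asymptotics.IsBigO.of_bound √5 ?_
        filter_upwards [isOpen_domain.mem_nhds hw] with y hy
        rw [Real.norm_of_nonneg (Real.sqrt_nonneg _)]
        exact sqrt_half_le (retract_mem hy) hS
      have hs : Tendsto (fun y => √((radiusSq (retract y) - 1) / 2)) (𝓝 w) (𝓝 0) := by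
        refine hO.trans_tendsto ?_
        have h1 : ContinuousAt (fun y => y - w) w := by fun_prop
        simpa using h1.tendsto
      have ho : K =o[𝓝 0] fun s => s := by
        have h1 := hasDerivAt_iff_isLittleO.1 hK0
        simpa [hK] using h1
      have hφw : φ w = 0 := by
        simp only [φ]
        rw [(mem_S4_iff hX).1 hS]
        simp [hK]
      rw [hzero, hasFDerivAt_iff_isLittleO]
      simp only [hφw, zero_apply, sub_zero]
      exact (ho.comp_tendsto hs).trans_isBigO hO
    · have hm : retract w ∈ X \ S4 := ⟨hX, hS⟩
      have ht := (mem_X_diff_S4_iff.1 hm).2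
      have h1 := (hKd _ ht).comp_hasFDerivAt (retract w) (hasFDerivAt_radiusSq (retract w))
      refine (h1.comp w (hρ w hw)).congr_fderiv ?_
      ext v
      rw [ContinuousLinearMap.comp_apply, ContinuousLinearMap.comp_apply, toForm_symm_apply,
        ha'.eq_radial hm (fderiv_retract_mem hw v), h0 _ ht]
      simp
  have hsmooth : ContDiffOn ℝ ∞ φ domain := by
    refine (contDiffOn_infty_iff_fderiv_of_isOpen isOpen_domain).2 ⟨fun w hw =>
      (hφ w hw).differentiableAt.differentiableWithinAt, ?_⟩
    have h1 : ContDiffOn ℝ ∞ (fun w => toForm.symm (a (retract w))) domain :=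
      toForm.symm.contDiff.comp_contDiffOn
        (haW.comp contDiffOn_retract fun w hw => hXW (retract_mem hw))
    exact (h1.clm_comp (contDiffOn_retract.fderiv_of_isOpen isOpen_domain (by simp))).congr
      fun w hw => (hφ w hw).fderiv
  refine isTrivialConnection_of_phase isOpen_domain X_subset_domain hsmooth ?_ ?_
  · intro h hh z _
    simp only [φ]
    rw [retract_act hh, radiusSq_act hh]
  · intro z hz v hv
    rw [(hφ z (X_subset_domain hz)).fderiv, ContinuousLinearMap.comp_apply,
      fderiv_retract_of_mem hz hv, retract_of_mem hz, toForm_symm_apply]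

/-- The field `∂_r` is tangent to `X`, and `∂_r(r²) = 2r`. -/
theorem radialField_mem_tangent {z : E} (hz : z ∈ X \ S4) :
    radialField z ∈ tangent z ∧ reL z (radialField z) = radius z := by
  obtain ⟨hX, ht⟩ := mem_X_diff_S4_iff.1 hz
  obtain ⟨hx, hy⟩ := sum_sq_eq_of_mem hX
  have hxy := (sum_sq_re_sub hX).2
  have hx0 : ∑ j, (z j).re ^ 2 ≠ 0 := by rw [hx]; linarith
  have hy0 : ∑ j, (z j).im ^ 2 ≠ 0 := by rw [hy]; linarith
  set A := ∑ j, (z j).re ^ 2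
  set B := ∑ j, (z j).im ^ 2
  have h1 : ∀ α β : ℝ, ∑ j, (α * (z j).re ^ 2 + β * (z j).im ^ 2) = α * A + β * B := by
    intro α β
    rw [Finset.sum_add_distrib, ← Finset.mul_sum, ← Finset.mul_sum]
  have hre : ∀ j, (radialField z j).re = radius z / (2 * A) * (z j).re := by
    intro j
    simp only [radialField, Complex.add_re, Complex.re_ofReal_mul, Complex.ofReal_re,
      Complex.I_re, mul_zero, add_zero]
    rfl
  have him : ∀ j, (radialField z j).im = radius z / (2 * B) * (z j).im := by
    intro j
    simp only [radialField, Complex.add_im, Complex.im_ofReal_mul, Complex.ofReal_im,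
      Complex.I_im, mul_one, zero_add]
    rfl
  constructor
  · rw [mem_tangent_iff]
    refine Complex.ext ?_ ?_
    · rw [bil, Complex.re_sum, Complex.zero_re]
      refine (Finset.sum_congr rfl fun j _ => ?_).trans
        ((h1 (radius z / (2 * A)) (-(radius z / (2 * B)))).trans ?_)
      · rw [Complex.mul_re, hre, him]
        ring
      · field_simp
        ring
    · rw [bil, Complex.im_sum, Complex.zero_im]
      refine (Finset.sum_congr rfl fun j _ => ?_).trans (((Finset.mul_sum _ _
        (radius z / (2 * A) + radius z / (2 * B))).symm).trans (by rw [hxy, mul_zero]))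
      rw [Complex.mul_im, hre, him]
      ring
  · rw [reL_apply, herm, Complex.re_sum]
    refine (Finset.sum_congr rfl fun j _ => ?_).trans
      ((h1 (radius z / (2 * A)) (radius z / (2 * B))).trans ?_)
    · rw [Complex.mul_re, Complex.conj_re, Complex.conj_im, hre, him]
      ring
    · field_simp
      ring

theorem isTrivialConnection_X_of_instanton {a : OneForm} (hc : IsConnection X a)
    (ha : IsInvariant X a) (hi : IsSpin7Instanton X a ∨ IsHYM X a) :
    IsTrivialConnection X a ∧ (IsTemporal a → ∀ z ∈ X, ∀ v ∈ tangent z, a z ![v] = 0) := by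
  have hc' := hc.mono (sdiff_subset (t := S4))
  have ha' : IsInvariant (X \ S4) a := ha.mono sdiff_subset
  obtain ⟨C, hG, -⟩ := exists_angularCoeff_mul_eq hc' ha'
    (hi.imp (fun h z hz => h z hz.1) (fun h z hz => h z hz.1))
  obtain rfl : C = 0 := eq_zero_of_curvature_extends hc
    (fun z hz v hv w hw => extDeriv_of_isInvariant hc' ha' hz hv hw) hG
  have h0 : ∀ t, 1 < t → angularCoeff a t = 0 := fun t ht => angularCoeff_eq_zero hG ht
  refine ⟨isTrivialConnection_X_of_angularCoeff_eq_zero hc ha h0, fun htemp z hz v hv => ?_⟩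
  -- In temporal gauge the radial coefficient vanishes as well.
  by_cases hS : z ∈ S4
  · exact ha.eq_zero_of_mem_S4 hS hv
  · have hm : z ∈ X \ S4 := ⟨hz, hS⟩
    have ht := (mem_X_diff_S4_iff.1 hm).2
    obtain ⟨h1, h2⟩ := radialField_mem_tangent hm
    have h3 := htemp z hm
    have hr : radius z ≠ 0 := Real.sqrt_ne_zero'.2 (by linarith)
    rw [ha'.eq_radial hm h1, h2, h0 _ ht, zero_mul, zero_add] at h3
    rw [ha'.eq_radial hm hv, h0 _ ht, (mul_eq_zero.1 h3).resolve_right (by positivity)]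
    ring

end Stenzel

end

theorem mainTheorem8 :
    (∀ a : Stenzel.OneForm,
      Stenzel.IsConnection (Stenzel.X \ Stenzel.S4) a →
      Stenzel.IsInvariant (Stenzel.X \ Stenzel.S4) a →
      (Stenzel.IsSpin7Instanton (Stenzel.X \ Stenzel.S4) a ∨
        Stenzel.IsHYM (Stenzel.X \ Stenzel.S4) a) →
      ¬ Stenzel.IsTrivialConnection (Stenzel.X \ Stenzel.S4) a →
        (∃ L : ℝ, 0 < L ∧
          Tendsto (fun z => |Stenzel.radius z - 1| ^ 4 * Stenzel.curvatureNormSq a z)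
            (comap Stenzel.radius (𝓝[>] 1) ⊓ 𝓟 Stenzel.X) (𝓝 L)) ∧
        Tendsto (Stenzel.curvatureNormSq a)
          (comap Stenzel.radius (𝓝[>] 1) ⊓ 𝓟 Stenzel.X) atTop ∧
        ¬ ∃ (b : Stenzel.OneForm) (u : Stenzel.E → ℂ),
          Stenzel.IsConnection Stenzel.X b ∧
          Stenzel.IsGauge (Stenzel.X \ Stenzel.S4) u ∧
          Stenzel.GaugeRelated (Stenzel.X \ Stenzel.S4) u a b) ∧
    (∀ a : Stenzel.OneForm,
      Stenzel.IsConnection Stenzel.X a →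
      Stenzel.IsInvariant Stenzel.X a →
      (Stenzel.IsSpin7Instanton Stenzel.X a ∨ Stenzel.IsHYM Stenzel.X a) →
        Stenzel.IsTrivialConnection Stenzel.X a ∧
        (Stenzel.IsTemporal a → ∀ z ∈ Stenzel.X, ∀ v ∈ Stenzel.tangent z, a z ![v] = 0)) := by
  exact ⟨fun a hc ha hi hnt => Stenzel.curvature_singular_of_not_trivial hc ha hi hnt,
    fun a hc ha hi => Stenzel.isTrivialConnection_X_of_instanton hc ha hi⟩
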